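/- **Notation.** For an integer $n$ put $\{n\}=\frac{q^{2n}-1}{q^2-1}\in\mathbb{Q}(q)$. For $x\in\mathbb{Q}$ with continued fraction $x=[a_1,\dots,a_{2m}]$ of even length ($a_1\in\mathbb{Z}$, $a_i\ge 1$ for $i\ge 2$), the $q$-rational is $$\{x\}=\{a_1\}+\cfrac{q^{2a_1}}{\{a_2\}_{q^{-1}}+\cfrac{q^{-2a_2}}{\{a_3\}+\cfrac{q^{2a_3}}{\ddots+\cfrac{q^{2a_{2m-1}}}{\{a_{2m}\}_{q^{-1}}}}}},$$ where $\{n\}_{q^{-1}}$ is $\{n\}$ with $q$ replaced by $q^{-1}$. Put $\delta_x=\{x\}-\{x-1\}$. Let $R=\mathbb{Q}(q)[\nu_x]$ with $\nu_x^2=\delta_x^{-1}$ (more generally, $R$ may be any commutative $\mathbb{Q}(q)$-algebra with an element $\nu_x$ such that $\nu_x^2\delta_x=1$), and put $$a=q\nu_x\delta_x,\qquad c_r=\frac{aq^{-r}-a^{-1}q^r}{q-q^{-1}},\qquad \mu_k=c_0c_1\cdots c_{k-1}\,\frac{q^{k(k-1)/2}}{\{k\}\{k-1\}\cdots\{1\}}\quad(\mu_0=1).$$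 Let $x\mathrm{Web}$ be the $R$-linear pivotal monoidal category whose objects are words in upward and downward arrows labelled by positive integers (arrows labelled $0$ are erased, webs with a negative label are zero) and whose morphisms are generated by merges $k\otimes l\to k+l$ and splits $k+l\to k\otimes l$ of upward strands, and by caps and cups of both orientations, up to planar isotopy, subject to: associativity of merges and of splits; the digon relation (splitting $k+l$ into $k,l$ and merging again is $q^{-kl}\frac{\{k+l\}\cdots\{l+1\}}{\{k\}\cdots\{1\}}$ times the identity); the square switch relation on two upward strands $(k,l)$, $[(k,l)\to(k-1,l+1)\to(k,l)]-[(k,l)\to(k+1,l-1)\to(k,l)]=q^{1-k+l}\{k-l\}\,\mathrm{id}$; the four Serre relations for ladders on three upward strands; the circle labelled $k$, in either orientation, is $\mu_k$; a sideway digon with edges $1,2$ on a strand labelled $1$, on either side, is $c_1$ times the strand; and the mixed square with edges labelled $1,2,1,2$ on $1{\uparrow}\,1{\downarrow}$ equals $\mathrm{id}+c_2\cdot(\text{cap followed by cup})$, together with its mirror image. Let $\mathcal{S}_2^x(1,1,0)=\mathrm{END}_{x\mathrm{Web}}\big(\bigoplus_{k\ge 0}(k{\uparrow},k{\downarrow})\big)$,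 i.e. the (locally unital) $R$-algebra $\bigoplus_{k,l\ge 0}\mathrm{Hom}_{x\mathrm{Web}}\big((k{\uparrow},k{\downarrow}),(l{\uparrow},l{\downarrow})\big)$ of matrices with finitely many non-zero entries. For $k\ge 0$ let $f_k\in\mathcal{S}_2^x(1,1,0)$ be the $k$-labelled cap $(k{\uparrow},k{\downarrow})\to\emptyset$ followed by the $k$-labelled cup $\emptyset\to(k{\uparrow},k{\downarrow})$. **Proposition.** Let $x\in\mathbb{Q}$ with $x\notin\mathbb{N}=\{0,1,2,\dots\}$. 1. For every $k$, the cup followed by the cap is $\mu_k\,\mathrm{id}_\emptyset$, and $\mu_k$ is invertible in $R$. One has $f_kf_l=\delta_{k,l}\,\mu_kf_k$, so that the elements $e_k=f_k/\mu_k$, $k\ge 0$, are orthogonal idempotents: $e_ke_l=\delta_{k,l}e_k$. 2. Let $A$ be a quotient algebra of $\mathcal{S}_2^x(1,1,0)$, with projection $\pi$, in which the identity of the empty web is not torsion (if $r\in R$ and $r\,\pi(\mathrm{id}_\emptyset)=0$, then $r=0$). Then the elements $\pi(e_k)$, $k\ge 0$, are linearly independent over $R$. 3. No non-zero quotient algebra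 of $\mathcal{S}_2^x(1,1,0)$ is finite-dimensional (finitely generated as an $R$-module). In particular, $\mathcal{S}_2^x(1,1,0)$ has no non-zero finite-dimensional torsion-free quotient. -/

import Mathlib

open CategoryTheory MonoidalCategory DirectSum

universe u v

noncomputable section

namespace QWeb

/-! ### Quantum integers and `q`-rationals (normalised in the variable `q ^ 2`) -/

/-- The indeterminate `q` of the field `ℚ(q)`. -/
def q : RatFunc ℚ := RatFunc.X

/-- `{n}`, evaluated at the value `t` of the indeterminate:
`{n}_t = (t ^ (2n) - 1) / (t ^ 2 - 1)`. -/
def qInt (t : RatFunc ℚ) (n : ℤ) : RatFunc ℚ := (t ^ (2 * n) - 1) / (t ^ 2 - 1)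

/-- The Gaussian binomial `{n}{n-1}⋯{n-k+1} / ({k}{k-1}⋯{1})`. -/
def qBinom (k : ℕ) (n : ℤ) : RatFunc ℚ :=
  ∏ i ∈ Finset.range k, qInt q (n - i) / qInt q (i + 1)

theorem evenCF_decreasing (x : ℚ)
    (h : ¬ ((x - (⌈x⌉ - 1 : ℤ))⁻¹ = (⌊(x - (⌈x⌉ - 1 : ℤ))⁻¹⌋ : ℚ))) :
    (((x - (⌈x⌉ - 1 : ℤ))⁻¹ - ⌊(x - (⌈x⌉ - 1 : ℤ))⁻¹⌋)⁻¹).den < x.den := by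
  have key : ∀ r : ℚ, 0 < r → r.num = (r⁻¹.den : ℤ) := by
    intro r hr
    have h1 : 0 < r.num := Rat.num_pos.mpr hr
    rw [Rat.den_inv_of_ne_zero hr.ne']
    omega
  have hy : 0 < x - (⌈x⌉ - 1 : ℤ) := by
    have := Int.ceil_lt_add_one x
    push_cast
    linarith
  set y := (x - (⌈x⌉ - 1 : ℤ))⁻¹ with hydef
  have hypos : 0 < y := inv_pos.mpr hy
  have hfr : 0 < y - ⌊y⌋ := by
    have h1 := Int.floor_le y
    rcases h1.lt_or_eq with h2 | h2
    · linarith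
    · exact absurd h2.symm h
  have hlt : y - ⌊y⌋ < 1 := by
    have := Int.lt_floor_add_one y
    linarith
  have hden : ∀ (z : ℚ) (n : ℤ), (z - n).den = z.den := fun z n => by
    simp
  have hyden : (y.den : ℤ) ≤ x.den := by
    rw [← key _ hy, ← hden x (⌈x⌉ - 1)]
    have hle : x - (⌈x⌉ - 1 : ℤ) ≤ 1 := by
      have := Int.le_ceil x
      push_cast
      linarith
    exact Rat.num_le_denom_iff.mpr hle
  have h2 : ((y - ⌊y⌋)⁻¹.den : ℤ) < y.den := by
    rw [← key _ hfr, ← hden y ⌊y⌋]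
    exact Rat.num_lt_denom_iff.mpr hlt
  omega

/-- The continued fraction expansion `[a₁, a₂, …, a₂ₘ]` of `x` of even length, with `aᵢ ≥ 1` for
`i ≥ 2`.  In odd positions the partial quotient `⌈x⌉ - 1` leaves a remainder in `(0, 1]`, so that
the expansion can only stop after an even position. -/
def evenCF (x : ℚ) : List ℤ :=
  if (x - (⌈x⌉ - 1 : ℤ))⁻¹ = (⌊(x - (⌈x⌉ - 1 : ℤ))⁻¹⌋ : ℚ) then
    [⌈x⌉ - 1, ⌊(x - (⌈x⌉ - 1 : ℤ))⁻¹⌋]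
  else
    (⌈x⌉ - 1) :: ⌊(x - (⌈x⌉ - 1 : ℤ))⁻¹⌋ ::
      evenCF ((x - (⌈x⌉ - 1 : ℤ))⁻¹ - ⌊(x - (⌈x⌉ - 1 : ℤ))⁻¹⌋)⁻¹
termination_by x.den
decreasing_by exact evenCF_decreasing x ‹_›

/-- The `q`-deformed continued fraction of a list of even length:
`{a₁} + q^(2a₁) / ({a₂}_{1/q} + q^(-2a₂) / ({a₃} + q^(2a₃) / (⋱ + q^(2aₙ₋₁) / {aₙ}_{1/q})))`.
(Lists of odd length do not occur and get the value `0`.) -/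
def qCF : List ℤ → RatFunc ℚ
  | [] => 0
  | [_] => 0
  | [a, b] => qInt q a + q ^ (2 * a) / qInt q⁻¹ b
  | a :: b :: c :: l =>
      qInt q a + q ^ (2 * a) / (qInt q⁻¹ b + q ^ (-2 * b) / qCF (c :: l))

/-- The `q`-rational `{x}`. -/
def qRat (x : ℚ) : RatFunc ℚ := qCF (evenCF x)

/-- `δ_x = {x} - {x - 1}`. -/
def qDelta (x : ℚ) : RatFunc ℚ := qRat x - qRat (x - 1)

/-! ### Objects and formal web expressions -/

/-- Words in upward and downward arrows labelled by positive integers. -/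
inductive WebObj : Type
  | one : WebObj
  | up (k : ℕ+) : WebObj
  | down (k : ℕ+) : WebObj
  | tensor (X Y : WebObj) : WebObj

local infixr:70 " ⊗ᵒ " => WebObj.tensor

/-- The upward strand labelled `k`; strands labelled `0` are erased. -/
def up : ℕ → WebObj
  | 0 => WebObj.one
  | k + 1 => WebObj.up k.succPNat

/-- The downward strand labelled `k`; strands labelled `0` are erased. -/
def dn : ℕ → WebObj
  | 0 => WebObj.one
  | k + 1 => WebObj.down k.succPNat

/-- Formal `R`-linear combinations of composites and juxtapositions of the elementary webs:
the two kinds of trivalent vertices, and caps and cups of both orientations. -/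
inductive WebTm (R : Type u) : WebObj → WebObj → Type u
  | id (X : WebObj) : WebTm R X X
  | comp {X Y Z : WebObj} (f : WebTm R X Y) (g : WebTm R Y Z) : WebTm R X Z
  | tensor {X Y X' Y' : WebObj} (f : WebTm R X Y) (g : WebTm R X' Y') :
      WebTm R (X ⊗ᵒ X') (Y ⊗ᵒ Y')
  | assoc (X Y Z : WebObj) : WebTm R ((X ⊗ᵒ Y) ⊗ᵒ Z) (X ⊗ᵒ (Y ⊗ᵒ Z))
  | assocInv (X Y Z : WebObj) : WebTm R (X ⊗ᵒ (Y ⊗ᵒ Z)) ((X ⊗ᵒ Y) ⊗ᵒ Z)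
  | lunit (X : WebObj) : WebTm R (WebObj.one ⊗ᵒ X) X
  | lunitInv (X : WebObj) : WebTm R X (WebObj.one ⊗ᵒ X)
  | runit (X : WebObj) : WebTm R (X ⊗ᵒ WebObj.one) X
  | runitInv (X : WebObj) : WebTm R X (X ⊗ᵒ WebObj.one)
  | zero (X Y : WebObj) : WebTm R X Y
  | add {X Y : WebObj} (f g : WebTm R X Y) : WebTm R X Y
  | smul {X Y : WebObj} (r : R) (f : WebTm R X Y) : WebTm R X Y
  /-- two upward strands `k`, `l` merge into one labelled `m = k + l` -/
  | merge (k l m : ℕ) (h : k + l = m) : WebTm R (up k ⊗ᵒ up l) (up m)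
  /-- an upward strand `m = k + l` splits into `k`, `l` -/
  | split (k l m : ℕ) (h : k + l = m) : WebTm R (up m) (up k ⊗ᵒ up l)
  /-- the cap oriented from left to right -/
  | capR (k : ℕ) : WebTm R (up k ⊗ᵒ dn k) WebObj.one
  /-- the cup oriented from left to right -/
  | cupR (k : ℕ) : WebTm R WebObj.one (dn k ⊗ᵒ up k)
  /-- the cap oriented from right to left -/
  | capL (k : ℕ) : WebTm R (dn k ⊗ᵒ up k) WebObj.one
  /-- the cup oriented from right to left -/
  | cupL (k : ℕ) : WebTm R WebObj.one (up k ⊗ᵒ dn k)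

namespace WebTm

local infixr:80 " ≫ᵗ " => WebTm.comp
local infixr:85 " ⊗ᵗ " => WebTm.tensor

variable {R : Type u}

/-- Transfer of `s` from the left strand to the right one: `(k' + s, l) → (k', l + s)`. -/
def rungR (s k' l : ℕ) : WebTm R (up (k' + s) ⊗ᵒ up l) (up k' ⊗ᵒ up (l + s)) :=
  (split k' s (k' + s) rfl ⊗ᵗ id (up l)) ≫ᵗ assoc _ _ _ ≫ᵗ
    (id (up k') ⊗ᵗ merge s l (l + s) (Nat.add_comm s l))

/-- Transfer of `s` from the right strand to the left one: `(k, l' + s) → (k + s, l')`. -/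
def rungL (s k l' : ℕ) : WebTm R (up k ⊗ᵒ up (l' + s)) (up (k + s) ⊗ᵒ up l') :=
  (id (up k) ⊗ᵗ split s l' (l' + s) (Nat.add_comm s l')) ≫ᵗ assocInv _ _ _ ≫ᵗ
    (merge k s (k + s) rfl ⊗ᵗ id (up l'))

/-- `(k, l) → (k - 1, l + 1) → (k, l)`; it is zero if `k = 0` (negative label). -/
def ladderRL : (k l : ℕ) → WebTm R (up k ⊗ᵒ up l) (up k ⊗ᵒ up l)
  | 0, _ => zero _ _
  | k + 1, l => rungR 1 k l ≫ᵗ rungL 1 k l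

/-- `(k, l) → (k + 1, l - 1) → (k, l)`; it is zero if `l = 0` (negative label). -/
def ladderLR : (k l : ℕ) → WebTm R (up k ⊗ᵒ up l) (up k ⊗ᵒ up l)
  | _, 0 => zero _ _
  | k, l + 1 => rungL 1 k l ≫ᵗ rungR 1 k l

/-- A two-strand web placed on the left two of three strands. -/
def onLeft {A B C D : WebObj} (f : WebTm R (A ⊗ᵒ B) (C ⊗ᵒ D)) (E : WebObj) :
    WebTm R ((A ⊗ᵒ B) ⊗ᵒ E) ((C ⊗ᵒ D) ⊗ᵒ E) := f ⊗ᵗ id E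

/-- A two-strand web placed on the right two of three strands. -/
def onRight {A B C D : WebObj} (E : WebObj) (f : WebTm R (A ⊗ᵒ B) (C ⊗ᵒ D)) :
    WebTm R ((E ⊗ᵒ A) ⊗ᵒ B) ((E ⊗ᵒ C) ⊗ᵒ D) :=
  assoc _ _ _ ≫ᵗ (id E ⊗ᵗ f) ≫ᵗ assocInv _ _ _

/-- `(k, l+1, r+1) → (k+2, l-1, r+1) → (k+2, l, r)`; it is zero if `l = 0` (negative label). -/
def serreEE : (k l r : ℕ) →
    WebTm R ((up k ⊗ᵒ up (l + 1)) ⊗ᵒ up (r + 1)) ((up (k + 2) ⊗ᵒ up l) ⊗ᵒ up r)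
  | _, 0, _ => zero _ _
  | k, l + 1, r => onLeft (rungL 2 k l) (up (r + 1)) ≫ᵗ onRight (up (k + 2)) (rungL 1 l r)

/-- `(k, l, r+2) → (k+1, l-1, r+2) → (k+1, l+1, r)`; it is zero if `l = 0` (negative label). -/
def serreEE' : (k l r : ℕ) →
    WebTm R ((up k ⊗ᵒ up l) ⊗ᵒ up (r + 2)) ((up (k + 1) ⊗ᵒ up (l + 1)) ⊗ᵒ up r)
  | _, 0, _ => zero _ _
  | k, l + 1, r => onLeft (rungL 1 k l) (up (r + 2)) ≫ᵗ onRight (up (k + 1)) (rungL 2 l r)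

/-- `(k+2, l, r) → (k+2, l-1, r+1) → (k, l+1, r+1)`; it is zero if `l = 0` (negative label). -/
def serreFF : (k l r : ℕ) →
    WebTm R ((up (k + 2) ⊗ᵒ up l) ⊗ᵒ up r) ((up k ⊗ᵒ up (l + 1)) ⊗ᵒ up (r + 1))
  | _, 0, _ => zero _ _
  | k, l + 1, r => onRight (up (k + 2)) (rungR 1 l r) ≫ᵗ onLeft (rungR 2 k l) (up (r + 1))

/-- `(k+1, l+1, r) → (k+1, l-1, r+2) → (k, l, r+2)`; it is zero if `l = 0` (negative label). -/
def serreFF' : (k l r : ℕ) →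
    WebTm R ((up (k + 1) ⊗ᵒ up (l + 1)) ⊗ᵒ up r) ((up k ⊗ᵒ up l) ⊗ᵒ up (r + 2))
  | _, 0, _ => zero _ _
  | k, l + 1, r => onRight (up (k + 1)) (rungR 2 l r) ≫ᵗ onLeft (rungR 1 k l) (up (r + 2))

/-- Rotation by a half turn, with the help of a cup and a cap. -/
def rotR {X X' Y Y' : WebObj} (coev : WebTm R WebObj.one (X' ⊗ᵒ X))
    (ev : WebTm R (Y ⊗ᵒ Y') WebObj.one) (f : WebTm R X Y) : WebTm R Y' X' :=
  lunitInv _ ≫ᵗ (coev ⊗ᵗ id Y') ≫ᵗ ((id X' ⊗ᵗ f) ⊗ᵗ id Y') ≫ᵗ assoc _ _ _ ≫ᵗ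
    (id X' ⊗ᵗ ev) ≫ᵗ runit _

/-- Rotation by a half turn in the other direction. -/
def rotL {X X' Y Y' : WebObj} (coev : WebTm R WebObj.one (X ⊗ᵒ X'))
    (ev : WebTm R (Y' ⊗ᵒ Y) WebObj.one) (f : WebTm R X Y) : WebTm R Y' X' :=
  runitInv _ ≫ᵗ (id Y' ⊗ᵗ coev) ≫ᵗ (id Y' ⊗ᵗ (f ⊗ᵗ id X')) ≫ᵗ assocInv _ _ _ ≫ᵗ
    (ev ⊗ᵗ id X') ≫ᵗ lunit _

/-- Two nested caps, given by an inner and an outer one. -/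
def nestCap {A A' B B' : WebObj} (outer : WebTm R (A ⊗ᵒ A') WebObj.one)
    (inner : WebTm R (B ⊗ᵒ B') WebObj.one) :
    WebTm R ((A ⊗ᵒ B) ⊗ᵒ (B' ⊗ᵒ A')) WebObj.one :=
  assoc _ _ _ ≫ᵗ (id A ⊗ᵗ (assocInv _ _ _ ≫ᵗ (inner ⊗ᵗ id A') ≫ᵗ lunit _)) ≫ᵗ outer

/-- Two nested cups, given by an inner and an outer one. -/
def nestCup {A A' B B' : WebObj} (outer : WebTm R WebObj.one (A ⊗ᵒ A'))
    (inner : WebTm R WebObj.one (B ⊗ᵒ B')) :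
    WebTm R WebObj.one ((A ⊗ᵒ B) ⊗ᵒ (B' ⊗ᵒ A')) :=
  outer ≫ᵗ (id A ⊗ᵗ (lunitInv _ ≫ᵗ (inner ⊗ᵗ id A') ≫ᵗ assoc _ _ _)) ≫ᵗ assocInv _ _ _

/-- Two upward strands labelled `1` that merge into one labelled `2`, which splits again. -/
def dumbbell : WebTm R (up 1 ⊗ᵒ up 1) (up 1 ⊗ᵒ up 1) :=
  merge 1 1 2 rfl ≫ᵗ split 1 1 2 rfl

/-- The strand `1` with a sideway digon on its right. -/
def sideDigonR : WebTm R (up 1) (up 1) :=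
  runitInv _ ≫ᵗ (id (up 1) ⊗ᵗ cupL 1) ≫ᵗ assocInv _ _ _ ≫ᵗ (dumbbell ⊗ᵗ id (dn 1)) ≫ᵗ
    assoc _ _ _ ≫ᵗ (id (up 1) ⊗ᵗ capR 1) ≫ᵗ runit _

/-- The strand `1` with a sideway digon on its left. -/
def sideDigonL : WebTm R (up 1) (up 1) :=
  lunitInv _ ≫ᵗ (cupR 1 ⊗ᵗ id (up 1)) ≫ᵗ assoc _ _ _ ≫ᵗ (id (dn 1) ⊗ᵗ dumbbell) ≫ᵗ
    assocInv _ _ _ ≫ᵗ (capL 1 ⊗ᵗ id (up 1)) ≫ᵗ lunit _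

/-- The `dumbbell` rotated by a quarter turn, so that its `2`-labelled edge points to the right. -/
def sideR : WebTm R (up 1 ⊗ᵒ dn 1) (dn 1 ⊗ᵒ up 1) :=
  lunitInv _ ≫ᵗ (cupR 1 ⊗ᵗ id (up 1 ⊗ᵒ dn 1)) ≫ᵗ assoc _ _ _ ≫ᵗ
    (id (dn 1) ⊗ᵗ (assocInv _ _ _ ≫ᵗ (dumbbell ⊗ᵗ id (dn 1)) ≫ᵗ assoc _ _ _ ≫ᵗ
      (id (up 1) ⊗ᵗ capR 1) ≫ᵗ runit _))

/-- The `dumbbell` rotated by a quarter turn, so that its `2`-labelled edge points to the left. -/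
def sideL : WebTm R (dn 1 ⊗ᵒ up 1) (up 1 ⊗ᵒ dn 1) :=
  runitInv _ ≫ᵗ (id (dn 1 ⊗ᵒ up 1) ⊗ᵗ cupL 1) ≫ᵗ assocInv _ _ _ ≫ᵗ
    ((assoc _ _ _ ≫ᵗ (id (dn 1) ⊗ᵗ dumbbell) ≫ᵗ assocInv _ _ _ ≫ᵗ
      (capL 1 ⊗ᵗ id (up 1)) ≫ᵗ lunit _) ⊗ᵗ id (dn 1))

end WebTm

/-! ### The web category -/

section Category

variable {R : Type u} [CommRing R] [Algebra (RatFunc ℚ) R]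

/-- `(a q^(-r) - a⁻¹ q^r) / (q - q⁻¹)`. -/
def aInt (a : Rˣ) (r : ℕ) : R :=
  (q - q⁻¹)⁻¹ • (q⁻¹ ^ r • (a : R) - q ^ r • ((a⁻¹ : Rˣ) : R))

/-- The value `μ_k` of the circle labelled `k`:
`μ_k = (∏_{i<k} (a q^(-i) - a⁻¹ q^i) / (q - q⁻¹)) * q^(k(k-1)/2) / ({k}{k-1}⋯{1})`. -/
def circleVal (a : Rˣ) (k : ℕ) : R :=
  (q ^ (k * (k - 1) / 2) / ∏ i ∈ Finset.range k, qInt q (i + 1)) •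
    ∏ i ∈ Finset.range k, aInt a i

local infixr:80 " ≫ᵗ " => WebTm.comp
local infixr:85 " ⊗ᵗ " => WebTm.tensor
local infixl:65 " +ᵗ " => WebTm.add
local infixr:90 " •ᵗ " => WebTm.smul

open WebTm in
/-- The relations between webs: the laws of an `R`-linear monoidal category, erasure of strands
labelled `0`, isotopy (zigzags and rotations of vertices), the relations between upward webs, and
the relations that involve both orientations.  Crossings are linear combinations of ladders and of
their rotations (for two strands labelled `1`: identity minus `q^±1` times the dumbbell), so the
braiding adds neither generators nor relations. -/
inductive WebRel (a : Rˣ) : {X Y : WebObj} → WebTm R X Y → WebTm R X Y → Prop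
  -- congruence
  | refl {X Y} (f : WebTm R X Y) : WebRel a f f
  | symm {X Y} {f g : WebTm R X Y} : WebRel a f g → WebRel a g f
  | trans {X Y} {f g h : WebTm R X Y} : WebRel a f g → WebRel a g h → WebRel a f h
  | comp_congr {X Y Z} {f f' : WebTm R X Y} {g g' : WebTm R Y Z} :
      WebRel a f f' → WebRel a g g' → WebRel a (f ≫ᵗ g) (f' ≫ᵗ g')
  | tensor_congr {X Y X' Y'} {f f' : WebTm R X Y} {g g' : WebTm R X' Y'} :
      WebRel a f f' → WebRel a g g' → WebRel a (f ⊗ᵗ g) (f' ⊗ᵗ g')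
  | add_congr {X Y} {f f' g g' : WebTm R X Y} :
      WebRel a f f' → WebRel a g g' → WebRel a (f +ᵗ g) (f' +ᵗ g')
  | smul_congr {X Y} (r : R) {f f' : WebTm R X Y} :
      WebRel a f f' → WebRel a (r •ᵗ f) (r •ᵗ f')
  -- category
  | id_comp {X Y} (f : WebTm R X Y) : WebRel a (id X ≫ᵗ f) f
  | comp_id {X Y} (f : WebTm R X Y) : WebRel a (f ≫ᵗ id Y) f
  | comp_assoc {W X Y Z} (f : WebTm R W X) (g : WebTm R X Y) (h : WebTm R Y Z) :
      WebRel a ((f ≫ᵗ g) ≫ᵗ h) (f ≫ᵗ (g ≫ᵗ h))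
  -- monoidal category
  | tensor_id (X Y : WebObj) : WebRel a (id X ⊗ᵗ id Y) (id (X ⊗ᵒ Y))
  | tensor_comp {X Y Z X' Y' Z'} (f : WebTm R X Y) (f' : WebTm R X' Y')
      (g : WebTm R Y Z) (g' : WebTm R Y' Z') :
      WebRel a ((f ⊗ᵗ f') ≫ᵗ (g ⊗ᵗ g')) ((f ≫ᵗ g) ⊗ᵗ (f' ≫ᵗ g'))
  | assoc_hom_inv (X Y Z : WebObj) : WebRel a (assoc X Y Z ≫ᵗ assocInv X Y Z) (WebTm.id _)
  | assoc_inv_hom (X Y Z : WebObj) : WebRel a (assocInv X Y Z ≫ᵗ assoc X Y Z) (WebTm.id _)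
  | lunit_hom_inv (X : WebObj) : WebRel a (lunit X ≫ᵗ lunitInv X) (WebTm.id _)
  | lunit_inv_hom (X : WebObj) : WebRel a (lunitInv X ≫ᵗ lunit X) (WebTm.id _)
  | runit_hom_inv (X : WebObj) : WebRel a (runit X ≫ᵗ runitInv X) (WebTm.id _)
  | runit_inv_hom (X : WebObj) : WebRel a (runitInv X ≫ᵗ runit X) (WebTm.id _)
  | assoc_nat {X Y X' Y' X'' Y''} (f : WebTm R X Y) (f' : WebTm R X' Y')
      (f'' : WebTm R X'' Y'') :
      WebRel a (((f ⊗ᵗ f') ⊗ᵗ f'') ≫ᵗ assoc Y Y' Y'') (assoc X X' X'' ≫ᵗ (f ⊗ᵗ (f' ⊗ᵗ f'')))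
  | lunit_nat {X Y} (f : WebTm R X Y) :
      WebRel a ((id WebObj.one ⊗ᵗ f) ≫ᵗ lunit Y) (lunit X ≫ᵗ f)
  | runit_nat {X Y} (f : WebTm R X Y) :
      WebRel a ((f ⊗ᵗ id WebObj.one) ≫ᵗ runit Y) (runit X ≫ᵗ f)
  | pentagon (W X Y Z : WebObj) :
      WebRel a ((assoc W X Y ⊗ᵗ id Z) ≫ᵗ assoc W (X ⊗ᵒ Y) Z ≫ᵗ (id W ⊗ᵗ assoc X Y Z))
        (assoc (W ⊗ᵒ X) Y Z ≫ᵗ assoc W X (Y ⊗ᵒ Z))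
  | triangle (X Y : WebObj) :
      WebRel a (assoc X WebObj.one Y ≫ᵗ (id X ⊗ᵗ lunit Y)) (runit X ⊗ᵗ id Y)
  -- linear structure
  | add_assoc {X Y} (f g h : WebTm R X Y) : WebRel a ((f +ᵗ g) +ᵗ h) (f +ᵗ (g +ᵗ h))
  | add_comm {X Y} (f g : WebTm R X Y) : WebRel a (f +ᵗ g) (g +ᵗ f)
  | zero_add {X Y} (f : WebTm R X Y) : WebRel a (zero X Y +ᵗ f) f
  | zero_smul {X Y} (f : WebTm R X Y) : WebRel a ((0 : R) •ᵗ f) (zero X Y)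
  | one_smul {X Y} (f : WebTm R X Y) : WebRel a ((1 : R) •ᵗ f) f
  | mul_smul {X Y} (r s : R) (f : WebTm R X Y) : WebRel a ((r * s) •ᵗ f) (r •ᵗ (s •ᵗ f))
  | add_smul {X Y} (r s : R) (f : WebTm R X Y) :
      WebRel a ((r + s) •ᵗ f) ((r •ᵗ f) +ᵗ (s •ᵗ f))
  | smul_add {X Y} (r : R) (f g : WebTm R X Y) :
      WebRel a (r •ᵗ (f +ᵗ g)) ((r •ᵗ f) +ᵗ (r •ᵗ g))
  | add_comp {X Y Z} (f g : WebTm R X Y) (h : WebTm R Y Z) :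
      WebRel a ((f +ᵗ g) ≫ᵗ h) ((f ≫ᵗ h) +ᵗ (g ≫ᵗ h))
  | comp_add {X Y Z} (f : WebTm R X Y) (g h : WebTm R Y Z) :
      WebRel a (f ≫ᵗ (g +ᵗ h)) ((f ≫ᵗ g) +ᵗ (f ≫ᵗ h))
  | smul_comp {X Y Z} (r : R) (f : WebTm R X Y) (g : WebTm R Y Z) :
      WebRel a ((r •ᵗ f) ≫ᵗ g) (r •ᵗ (f ≫ᵗ g))
  | comp_smul {X Y Z} (r : R) (f : WebTm R X Y) (g : WebTm R Y Z) :
      WebRel a (f ≫ᵗ (r •ᵗ g)) (r •ᵗ (f ≫ᵗ g))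
  | add_tensor {X Y X' Y'} (f g : WebTm R X Y) (h : WebTm R X' Y') :
      WebRel a ((f +ᵗ g) ⊗ᵗ h) ((f ⊗ᵗ h) +ᵗ (g ⊗ᵗ h))
  | tensor_add {X Y X' Y'} (f : WebTm R X Y) (g h : WebTm R X' Y') :
      WebRel a (f ⊗ᵗ (g +ᵗ h)) ((f ⊗ᵗ g) +ᵗ (f ⊗ᵗ h))
  | smul_tensor {X Y X' Y'} (r : R) (f : WebTm R X Y) (g : WebTm R X' Y') :
      WebRel a ((r •ᵗ f) ⊗ᵗ g) (r •ᵗ (f ⊗ᵗ g))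
  | tensor_smul {X Y X' Y'} (r : R) (f : WebTm R X Y) (g : WebTm R X' Y') :
      WebRel a (f ⊗ᵗ (r •ᵗ g)) (r •ᵗ (f ⊗ᵗ g))
  -- strands labelled `0` are erased
  | merge_zero_left (l : ℕ) : WebRel a (merge 0 l l (Nat.zero_add l)) (lunit (up l))
  | merge_zero_right (k : ℕ) : WebRel a (merge k 0 k (Nat.add_zero k)) (runit (up k))
  | split_zero_left (l : ℕ) : WebRel a (split 0 l l (Nat.zero_add l)) (lunitInv (up l))
  | split_zero_right (k : ℕ) : WebRel a (split k 0 k (Nat.add_zero k)) (runitInv (up k))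
  | capR_zero : WebRel a (capR 0) (lunit WebObj.one)
  | cupR_zero : WebRel a (cupR 0) (lunitInv WebObj.one)
  | capL_zero : WebRel a (capL 0) (lunit WebObj.one)
  | cupL_zero : WebRel a (cupL 0) (lunitInv WebObj.one)
  -- isotopy: caps and cups straighten
  | zigzag_up_right (k : ℕ) :
      WebRel a (runitInv (up k) ≫ᵗ (id (up k) ⊗ᵗ cupR k) ≫ᵗ assocInv _ _ _ ≫ᵗ
        (capR k ⊗ᵗ id (up k)) ≫ᵗ lunit (up k)) (id (up k))
  | zigzag_down_right (k : ℕ) :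
      WebRel a (lunitInv (dn k) ≫ᵗ (cupR k ⊗ᵗ id (dn k)) ≫ᵗ assoc _ _ _ ≫ᵗ
        (id (dn k) ⊗ᵗ capR k) ≫ᵗ runit (dn k)) (id (dn k))
  | zigzag_up_left (k : ℕ) :
      WebRel a (lunitInv (up k) ≫ᵗ (cupL k ⊗ᵗ id (up k)) ≫ᵗ assoc _ _ _ ≫ᵗ
        (id (up k) ⊗ᵗ capL k) ≫ᵗ runit (up k)) (id (up k))
  | zigzag_down_left (k : ℕ) :
      WebRel a (runitInv (dn k) ≫ᵗ (id (dn k) ⊗ᵗ cupL k) ≫ᵗ assocInv _ _ _ ≫ᵗ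
        (capL k ⊗ᵗ id (dn k)) ≫ᵗ lunit (dn k)) (id (dn k))
  -- isotopy: turning a vertex upside down to the left or to the right gives the same web
  | rot_merge (k l m : ℕ) (h : k + l = m) :
      WebRel a (rotR (nestCup (cupR l) (cupR k)) (capR m) (merge k l m h))
        (rotL (nestCup (cupL k) (cupL l)) (capL m) (merge k l m h))
  | rot_split (k l m : ℕ) (h : k + l = m) :
      WebRel a (rotR (cupR m) (nestCap (capR k) (capR l)) (split k l m h))
        (rotL (cupL m) (nestCap (capL l) (capL k)) (split k l m h))
  -- upward webs
  | merge_assoc (k l r kl lr m : ℕ) (h₁ : k + l = kl) (h₂ : kl + r = m) (h₃ : l + r = lr)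
      (h₄ : k + lr = m) :
      WebRel a ((merge k l kl h₁ ⊗ᵗ id (up r)) ≫ᵗ merge kl r m h₂)
        (assoc _ _ _ ≫ᵗ (id (up k) ⊗ᵗ merge l r lr h₃) ≫ᵗ merge k lr m h₄)
  | split_assoc (k l r kl lr m : ℕ) (h₁ : k + l = kl) (h₂ : kl + r = m) (h₃ : l + r = lr)
      (h₄ : k + lr = m) :
      WebRel a (split kl r m h₂ ≫ᵗ (split k l kl h₁ ⊗ᵗ id (up r)) ≫ᵗ assoc _ _ _)
        (split k lr m h₄ ≫ᵗ (id (up k) ⊗ᵗ split l r lr h₃))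
  | digon (k l m : ℕ) (h : k + l = m) :
      WebRel a (split k l m h ≫ᵗ merge k l m h)
        (algebraMap (RatFunc ℚ) R (q⁻¹ ^ (k * l) * qBinom k m) •ᵗ id (up m))
  | square_switch (k l : ℕ) :
      WebRel a (ladderRL k l)
        (ladderLR k l +ᵗ
          algebraMap (RatFunc ℚ) R (q ^ (1 - k + l : ℤ) * qInt q (k - l)) •ᵗ id (up k ⊗ᵒ up l))
  | serre_left₁ (k l r : ℕ) :
      WebRel a
        ((onRight (up k) (rungL 1 (l + 1) r) ≫ᵗ onLeft (rungL 2 k l) (up r)) +ᵗ serreEE k l r)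
        (onLeft (rungL 1 k l) (up (r + 1)) ≫ᵗ onRight (up (k + 1)) (rungL 1 l r) ≫ᵗ
          onLeft (rungL 1 (k + 1) l) (up r))
  | serre_left₂ (k l r : ℕ) :
      WebRel a
        (serreEE' k l r +ᵗ (onRight (up k) (rungL 2 l r) ≫ᵗ onLeft (rungL 1 k (l + 1)) (up r)))
        (onRight (up k) (rungL 1 l (r + 1)) ≫ᵗ onLeft (rungL 1 k l) (up (r + 1)) ≫ᵗ
          onRight (up (k + 1)) (rungL 1 l r))
  | serre_right₁ (k l r : ℕ) :
      WebRel a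
        (serreFF k l r +ᵗ (onLeft (rungR 2 k l) (up r) ≫ᵗ onRight (up k) (rungR 1 (l + 1) r)))
        (onLeft (rungR 1 (k + 1) l) (up r) ≫ᵗ onRight (up (k + 1)) (rungR 1 l r) ≫ᵗ
          onLeft (rungR 1 k l) (up (r + 1)))
  | serre_right₂ (k l r : ℕ) :
      WebRel a
        ((onLeft (rungR 1 k (l + 1)) (up r) ≫ᵗ onRight (up k) (rungR 2 l r)) +ᵗ serreFF' k l r)
        (onRight (up (k + 1)) (rungR 1 l r) ≫ᵗ onLeft (rungR 1 k l) (up (r + 1)) ≫ᵗ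
          onRight (up k) (rungR 1 l (r + 1)))
  -- circles
  | circle_cw (k : ℕ) :
      WebRel a (cupL k ≫ᵗ capR k) (circleVal a k •ᵗ id WebObj.one)
  | circle_ccw (k : ℕ) :
      WebRel a (cupR k ≫ᵗ capL k) (circleVal a k •ᵗ id WebObj.one)
  -- sideway digons
  | side_digon_right : WebRel a sideDigonR (aInt a 1 •ᵗ id (up 1))
  | side_digon_left : WebRel a sideDigonL (aInt a 1 •ᵗ id (up 1))
  -- mixed square and its mirror image
  | square : WebRel a (sideR ≫ᵗ sideL)
      (id (up 1 ⊗ᵒ dn 1) +ᵗ aInt a 2 •ᵗ (capR 1 ≫ᵗ cupL 1))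
  | square_mirror : WebRel a (sideL ≫ᵗ sideR)
      (id (dn 1 ⊗ᵒ up 1) +ᵗ aInt a 2 •ᵗ (capL 1 ≫ᵗ cupR 1))

/-- The setoid of web relations. -/
def webSetoid (a : Rˣ) (X Y : WebObj) : Setoid (WebTm R X Y) :=
  ⟨WebRel a, WebRel.refl, WebRel.symm, WebRel.trans⟩

/-- The category of webs with parameters `q` and `a` and coefficients in `R`, that is, the base
change to `R` of the universal web category over `ℤ[q^±1, a^±1][(q - q⁻¹)⁻¹]`. -/
structure InfWeb (a : Rˣ) : Type where
  /-- the underlying word -/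
  word : WebObj

/-- Webs modulo relations. -/
def WebHom (a : Rˣ) (X Y : WebObj) : Type u := Quotient (webSetoid a X Y)

namespace WebHom

variable {a : Rˣ}

/-- The class of a formal web expression. -/
def mk (a : Rˣ) {X Y : WebObj} (f : WebTm R X Y) : WebHom a X Y := Quotient.mk (webSetoid a X Y) f

theorem sound {X Y : WebObj} {f g : WebTm R X Y} (h : WebRel a f g) : mk a f = mk a g :=
  Quotient.sound h

/-- Composition of webs. -/
def comp {X Y Z : WebObj} (f : WebHom a X Y) (g : WebHom a Y Z) : WebHom a X Z :=
  Quotient.liftOn₂ f g (fun f g => mk a (f ≫ᵗ g))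
    fun _ _ _ _ h h' => sound (WebRel.comp_congr h h')

/-- Juxtaposition of webs. -/
def tensor {X Y X' Y' : WebObj} (f : WebHom a X Y) (g : WebHom a X' Y') :
    WebHom a (X ⊗ᵒ X') (Y ⊗ᵒ Y') :=
  Quotient.liftOn₂ f g (fun f g => mk a (f ⊗ᵗ g))
    fun _ _ _ _ h h' => sound (WebRel.tensor_congr h h')

instance (X Y : WebObj) : Zero (WebHom a X Y) := ⟨mk a (WebTm.zero X Y)⟩

instance (X Y : WebObj) : Add (WebHom a X Y) :=
  ⟨fun f g => Quotient.liftOn₂ f g (fun f g => mk a (f +ᵗ g))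
    fun _ _ _ _ h h' => sound (WebRel.add_congr h h')⟩

instance (X Y : WebObj) : SMul R (WebHom a X Y) :=
  ⟨fun r f => Quotient.liftOn f (fun f => mk a (r •ᵗ f))
    fun _ _ h => sound (WebRel.smul_congr r h)⟩

instance (X Y : WebObj) : Neg (WebHom a X Y) := ⟨fun f => (-1 : R) • f⟩

theorem mk_add {X Y : WebObj} (f g : WebTm R X Y) : mk a (f +ᵗ g) = mk a f + mk a g := rfl

theorem mk_smul {X Y : WebObj} (r : R) (f : WebTm R X Y) : mk a (r •ᵗ f) = r • mk a f := rfl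

theorem ind {X Y : WebObj} {p : WebHom a X Y → Prop} (h : ∀ f, p (mk a f)) (f : WebHom a X Y) :
    p f := Quotient.ind h f

theorem zero_smul' {X Y : WebObj} (f : WebHom a X Y) : (0 : R) • f = 0 := by
  induction f using ind with | h f => exact sound (WebRel.zero_smul f)

theorem one_smul' {X Y : WebObj} (f : WebHom a X Y) : (1 : R) • f = f := by
  induction f using ind with | h f => exact sound (WebRel.one_smul f)

theorem add_smul' {X Y : WebObj} (r s : R) (f : WebHom a X Y) :
    (r + s) • f = r • f + s • f := by
  induction f using ind with | h f => exact sound (WebRel.add_smul r s f)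

theorem mul_smul' {X Y : WebObj} (r s : R) (f : WebHom a X Y) :
    (r * s) • f = r • s • f := by
  induction f using ind with | h f => exact sound (WebRel.mul_smul r s f)

theorem add_comm' {X Y : WebObj} (f g : WebHom a X Y) : f + g = g + f := by
  induction f using ind with | h f =>
  induction g using ind with | h g => exact sound (WebRel.add_comm f g)

theorem zero_add' {X Y : WebObj} (f : WebHom a X Y) : 0 + f = f := by
  induction f using ind with | h f => exact sound (WebRel.zero_add f)

instance (X Y : WebObj) : AddCommGroup (WebHom a X Y) where
  add_assoc f g h := by
    induction f using ind with | h f =>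
    induction g using ind with | h g =>
    induction h using ind with | h h => exact sound (WebRel.add_assoc f g h)
  zero_add := zero_add'
  add_zero f := by rw [add_comm', zero_add']
  add_comm := add_comm'
  neg_add_cancel f := by
    change (-1 : R) • f + f = 0
    nth_rewrite 2 [← one_smul' f]
    rw [← add_smul', neg_add_cancel, zero_smul']
  nsmul := nsmulRec
  zsmul := zsmulRec

instance (X Y : WebObj) : Module R (WebHom a X Y) where
  one_smul := one_smul'
  mul_smul := mul_smul'
  smul_zero r := by
    rw [← zero_smul' (0 : WebHom a X Y), ← mul_smul', mul_zero]
  smul_add r f g := by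
    induction f using ind with | h f =>
    induction g using ind with | h g => exact sound (WebRel.smul_add r f g)
  add_smul := add_smul'
  zero_smul := zero_smul'

end WebHom

open WebHom

instance (a : Rˣ) : Category.{u} (InfWeb a) where
  Hom X Y := WebHom a X.word Y.word
  id X := WebHom.mk a (WebTm.id X.word)
  comp f g := WebHom.comp f g
  id_comp f := by
    induction f using ind with | h f => exact sound (WebRel.id_comp f)
  comp_id f := by
    induction f using ind with | h f => exact sound (WebRel.comp_id f)
  assoc f g h := by
    induction f using ind with | h f =>
    induction g using ind with | h g =>
    induction h using ind with | h h => exact sound (WebRel.comp_assoc f g h)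

instance (a : Rˣ) : Preadditive (InfWeb a) where
  homGroup X Y := inferInstanceAs (AddCommGroup (WebHom a X.word Y.word))
  add_comp _ _ _ f g h := by
    induction f using ind with | h f =>
    induction g using ind with | h g =>
    induction h using ind with | h h => exact sound (WebRel.add_comp f g h)
  comp_add _ _ _ f g h := by
    induction f using ind with | h f =>
    induction g using ind with | h g =>
    induction h using ind with | h h => exact sound (WebRel.comp_add f g h)

instance (a : Rˣ) : Linear R (InfWeb a) where
  homModule X Y := inferInstanceAs (Module R (WebHom a X.word Y.word))
  smul_comp _ _ _ r f g := by
    induction f using ind with | h f =>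
    induction g using ind with | h g => exact sound (WebRel.smul_comp r f g)
  comp_smul _ _ _ f r g := by
    induction f using ind with | h f =>
    induction g using ind with | h g => exact sound (WebRel.comp_smul r f g)

instance (a : Rˣ) : MonoidalCategoryStruct (InfWeb a) where
  tensorObj X Y := ⟨X.word ⊗ᵒ Y.word⟩
  tensorUnit := ⟨WebObj.one⟩
  tensorHom f g := WebHom.tensor f g
  whiskerLeft X _ _ f := WebHom.tensor (WebHom.mk a (WebTm.id X.word)) f
  whiskerRight f Y := WebHom.tensor f (WebHom.mk a (WebTm.id Y.word))
  associator X Y Z :=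
    { hom := WebHom.mk a (WebTm.assoc X.word Y.word Z.word)
      inv := WebHom.mk a (WebTm.assocInv X.word Y.word Z.word)
      hom_inv_id := sound (WebRel.assoc_hom_inv _ _ _)
      inv_hom_id := sound (WebRel.assoc_inv_hom _ _ _) }
  leftUnitor X :=
    { hom := WebHom.mk a (WebTm.lunit X.word)
      inv := WebHom.mk a (WebTm.lunitInv X.word)
      hom_inv_id := sound (WebRel.lunit_hom_inv _)
      inv_hom_id := sound (WebRel.lunit_inv_hom _) }
  rightUnitor X :=
    { hom := WebHom.mk a (WebTm.runit X.word)
      inv := WebHom.mk a (WebTm.runitInv X.word)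
      hom_inv_id := sound (WebRel.runit_hom_inv _)
      inv_hom_id := sound (WebRel.runit_inv_hom _) }

instance (a : Rˣ) : MonoidalCategory (InfWeb a) :=
  MonoidalCategory.ofTensorHom
    (id_tensorHom_id := fun _ _ => sound (WebRel.tensor_id _ _))
    (id_tensorHom := fun _ _ _ _ => rfl)
    (tensorHom_id := fun _ _ => rfl)
    (tensorHom_comp_tensorHom := fun f f' g g' => by
      induction f using ind with | h f =>
      induction f' using ind with | h f' =>
      induction g using ind with | h g =>
      induction g' using ind with | h g' => exact sound (WebRel.tensor_comp f f' g g'))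
    (associator_naturality := fun f f' f'' => by
      induction f using ind with | h f =>
      induction f' using ind with | h f' =>
      induction f'' using ind with | h f'' => exact sound (WebRel.assoc_nat f f' f''))
    (leftUnitor_naturality := fun f => by
      induction f using ind with | h f => exact sound (WebRel.lunit_nat f))
    (rightUnitor_naturality := fun f => by
      induction f using ind with | h f => exact sound (WebRel.runit_nat f))
    (pentagon := fun _ _ _ _ => sound (WebRel.pentagon _ _ _ _))
    (triangle := fun _ _ => sound (WebRel.triangle _ _))

/-! ### The doubled Schur algebra `S₂(1, 1, 0)` -/

/-- The object `(k↑, k↓)`. -/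
def upDown (a : Rˣ) (k : ℕ) : InfWeb a := ⟨up k ⊗ᵒ dn k⟩

/-- The cap `(k↑, k↓) → ∅`. -/
def webCap (a : Rˣ) (k : ℕ) : upDown a k ⟶ 𝟙_ (InfWeb a) := WebHom.mk a (WebTm.capR k)

/-- The cup `∅ → (k↑, k↓)`. -/
def webCup (a : Rˣ) (k : ℕ) : 𝟙_ (InfWeb a) ⟶ upDown a k := WebHom.mk a (WebTm.cupL k)

/-- The algebra of endomorphisms of the formal direct sum of all the objects `(k↑, k↓)`, `k ≥ 0`:
matrices with finitely many non-zero entries, the entry `(k, l)` being a morphism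
`(k↑, k↓) → (l↑, l↓)`. -/
abbrev Schur (a : Rˣ) : Type u := ⨁ p : ℕ × ℕ, (upDown a p.1 ⟶ upDown a p.2)

namespace Schur

variable (a : Rˣ)

/-- The matrix with a single entry, a morphism `(k↑, k↓) → (l↑, l↓)`. -/
def entry (k l : ℕ) : (upDown a k ⟶ upDown a l) →ₗ[R] Schur a :=
  DirectSum.lof R (ℕ × ℕ) (fun p : ℕ × ℕ => (upDown a p.1 ⟶ upDown a p.2)) (k, l)

/-- The product of two entries: `g * f = g ∘ f` if source and target match, and `0` otherwise. -/
def entryMul (p p' : ℕ × ℕ) :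
    (upDown a p.1 ⟶ upDown a p.2) →ₗ[R] (upDown a p'.1 ⟶ upDown a p'.2) →ₗ[R] Schur a :=
  if h : p'.2 = p.1 then
    LinearMap.mk₂ R
      (fun g f => entry a p'.1 p.2 (f ≫ eqToHom (congrArg (upDown a) h) ≫ g))
      (fun g g' f => by simp) (fun r g f => by simp)
      (fun g f f' => by simp) (fun r g f => by simp)
  else 0

/-- Matrix multiplication, as a bilinear map. -/
def mulLin : Schur a →ₗ[R] Schur a →ₗ[R] Schur a :=
  DirectSum.toModule R (ℕ × ℕ) (Schur a →ₗ[R] Schur a) fun p =>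
    (DirectSum.toModule R (ℕ × ℕ) ((upDown a p.1 ⟶ upDown a p.2) →ₗ[R] Schur a)
      fun p' => (entryMul a p p').flip).flip

instance : Mul (Schur a) := ⟨fun g f => mulLin a g f⟩

theorem mul_def (g f : Schur a) : g * f = mulLin a g f := rfl

theorem entry_mul_entry (k l k' l' : ℕ) (g : upDown a k ⟶ upDown a l)
    (f : upDown a k' ⟶ upDown a l') :
    entry a k l g * entry a k' l' f = entryMul a (k, l) (k', l') g f := by
  rw [mul_def, mulLin, entry, entry, DirectSum.toModule_lof, LinearMap.flip_apply,
    DirectSum.toModule_lof, LinearMap.flip_apply]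

theorem entry_mul_entry_self (k l m : ℕ) (g : upDown a l ⟶ upDown a m)
    (f : upDown a k ⟶ upDown a l) :
    entry a l m g * entry a k l f = entry a k m (f ≫ g) := by
  rw [entry_mul_entry, entryMul, dif_pos rfl]
  simp

theorem entry_mul_entry_of_ne (k l l' m : ℕ) (h : l ≠ l') (g : upDown a l' ⟶ upDown a m)
    (f : upDown a k ⟶ upDown a l) :
    entry a l' m g * entry a k l f = 0 := by
  rw [entry_mul_entry, entryMul, dif_neg h]
  rfl

theorem induct {P : Schur a → Prop} (h0 : P 0)
    (h1 : ∀ (k l : ℕ) (f : upDown a k ⟶ upDown a l), P (entry a k l f))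
    (h2 : ∀ f g, P f → P g → P (f + g)) (f : Schur a) : P f :=
  DirectSum.induction_on f h0 (fun p f => h1 p.1 p.2 f) h2

theorem mul_add' (f g h : Schur a) : f * (g + h) = f * g + f * h := by simp [mul_def]

theorem add_mul' (f g h : Schur a) : (f + g) * h = f * h + g * h := by simp [mul_def]

theorem zero_mul' (f : Schur a) : 0 * f = 0 := by simp [mul_def]

theorem mul_zero' (f : Schur a) : f * 0 = 0 := by simp [mul_def]

theorem mul_assoc' (f g h : Schur a) : f * g * h = f * (g * h) := by
  induction f using induct with
  | h0 => simp only [zero_mul']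
  | h2 f f' hf hf' => simp only [add_mul', hf, hf']
  | h1 k l f =>
    induction g using induct with
    | h0 => simp only [zero_mul', mul_zero']
    | h2 g g' hg hg' => simp only [add_mul', mul_add', hg, hg']
    | h1 k' l' g =>
      induction h using induct with
      | h0 => simp only [mul_zero']
      | h2 h h' hh hh' => simp only [mul_add', hh, hh']
      | h1 k'' l'' h =>
        by_cases e : l' = k
        · subst e
          by_cases e' : l'' = k'
          · subst e'
            simp only [entry_mul_entry_self, Category.assoc]
          · simp only [entry_mul_entry_self, entry_mul_entry_of_ne a _ _ _ _ e', mul_zero']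
        · by_cases e' : l'' = k'
          · subst e'
            simp only [entry_mul_entry_self, entry_mul_entry_of_ne a _ _ _ _ e, zero_mul']
          · simp only [entry_mul_entry_of_ne a _ _ _ _ e, entry_mul_entry_of_ne a _ _ _ _ e',
              zero_mul', mul_zero']

instance : NonUnitalRing (Schur a) where
  left_distrib := mul_add' a
  right_distrib := add_mul' a
  zero_mul := zero_mul' a
  mul_zero := mul_zero' a
  mul_assoc := mul_assoc' a

instance : IsScalarTower R (Schur a) (Schur a) :=
  ⟨fun r f g => by simp [mul_def]⟩

instance : SMulCommClass R (Schur a) (Schur a) :=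
  ⟨fun r f g => by simp [mul_def]⟩

/-- The web `f_k`: a cap labelled `k` followed by a cup labelled `k`. -/
def capCup (k : ℕ) : Schur a := entry a k k (webCap a k ≫ webCup a k)

/-- `e_k = f_k / μ_k` (meaningful if `μ_k` is invertible). -/
def idem (k : ℕ) : Schur a := Ring.inverse (circleVal a k) • capCup a k

/-- The identity of the object without strands, `(0↑, 0↓)`: the empty web. -/
def emptyWeb : Schur a := entry a 0 0 (𝟙 (upDown a 0))

end Schur

end Category

/-! ### The specialisation at a rational number -/

/-- The parameter `a = q ν_x δ_x`, where `ν_x ^ 2 = δ_x⁻¹`; its inverse is `q⁻¹ ν_x`. -/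
def xParam {R : Type u} [CommRing R] [Algebra (RatFunc ℚ) R] (x : ℚ) (ν : R)
    (hν : ν ^ 2 * algebraMap (RatFunc ℚ) R (qDelta x) = 1) : Rˣ where
  val := algebraMap (RatFunc ℚ) R q * ν * algebraMap (RatFunc ℚ) R (qDelta x)
  inv := algebraMap (RatFunc ℚ) R q⁻¹ * ν
  val_inv := by
    have hq : algebraMap (RatFunc ℚ) R q * algebraMap (RatFunc ℚ) R q⁻¹ = 1 := by
      rw [← map_mul, mul_inv_cancel₀ (by simpa [q] using RatFunc.X_ne_zero), map_one]
    linear_combination ν ^ 2 * algebraMap (RatFunc ℚ) R (qDelta x) * hq + hν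
  inv_val := by
    have hq : algebraMap (RatFunc ℚ) R q * algebraMap (RatFunc ℚ) R q⁻¹ = 1 := by
      rw [← map_mul, mul_inv_cancel₀ (by simpa [q] using RatFunc.X_ne_zero), map_one]
    linear_combination ν ^ 2 * algebraMap (RatFunc ℚ) R (qDelta x) * hq + hν

/-- The category of webs with parameter `x`. -/
abbrev XWeb {R : Type u} [CommRing R] [Algebra (RatFunc ℚ) R] (x : ℚ) (ν : R)
    (hν : ν ^ 2 * algebraMap (RatFunc ℚ) R (qDelta x) = 1) : Type :=
  InfWeb (xParam x ν hν)

/-- The `x`-analogue `S₂ˣ(1, 1, 0)` of the doubled Schur algebra. -/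
abbrev XSchur {R : Type u} [CommRing R] [Algebra (RatFunc ℚ) R] (x : ℚ) (ν : R)
    (hν : ν ^ 2 * algebraMap (RatFunc ℚ) R (qDelta x) = 1) : Type u :=
  Schur (xParam x ν hν)

end QWeb

end

/-! The circle values are invertible because the `q`-rational of `x` specialises to `x` at `q = 1`.
Up to the unit `ν` and nonzero scalars, `c_r` is `q ^ 2 * δ_x - q ^ (2r)`, and `q ^ 2 * δ_x = (q ^ 2
- 1) * {x} + 1`. If `c_r` vanished, then `{x} = {r}`, and evaluation at `q = 1` would give `x = r`,
which is excluded for natural `r`. So every `c_r`, hence every `μ_k`, is a unit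
(`isUnit_aInt_xParam`, `isUnit_circleVal`). The circle relation then yields the orthogonal
idempotents. Placing a linear relation between the `k`-cap and the `k`-cup isolates its `k`-th
coefficient on the empty web, which gives linear independence.

Infinite-dimensionality rests on an `sl₂`-type argument. Let `E` raise `(k↑, k↓)` to `((k+1)↑,
(k+1)↓)` by creating an inner cup and merging it into the outer strands, and let `F` lower by
splitting off an inner cap. The web relations give `FE = EF + c_{2k}` on `(k↑, k↓)`, without the
term `EF` if `k = 0` (`webRaise_webLower_zero`, `webRaise_webLower_succ`; the core is
`raise_lower_eq`).

In a quotient where the identities of all objects below `j` vanish, `j` behaves like a lowest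
weight: `F E^(m+1) = (c_{2j} + c_{2j+2} + ⋯ + c_{2j+2m}) E^m` on `(j↑, j↓)`. The sum equals `[m+1]
c_{2j+m}`, where `[n] = (q^n - q^(-n)) / (q - q⁻¹)`, and is a unit. Thus if `E^N` vanishes on `j`
for some `N`, then so does the identity of `j`.

In a finitely generated quotient every generator has only finitely many nonzero rows, so the
identities of all large objects act as zero and hence are zero. Powers of `E` that reach these
objects vanish; by strong induction all identities vanish, and the quotient is zero. -/

set_option linter.unusedSectionVars false

namespace QWeb

/-! ### Mates -/

section Mates

variable {C : Type u} [Category.{v} C] [MonoidalCategory C]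

/-- The right adjoint mate of `f : X ⟶ Y` for chosen duals of `X` and `Y`. -/
def mate {X Y : C} (X' Y' : C) [ExactPairing X X'] [ExactPairing Y Y'] (f : X ⟶ Y) : Y' ⟶ X' :=
  letI : HasRightDual X := ⟨X'⟩
  letI : HasRightDual Y := ⟨Y'⟩
  rightAdjointMate f

variable {X Y Z X' Y' Z' : C} [ExactPairing X X'] [ExactPairing Y Y'] [ExactPairing Z Z']

theorem mate_def (f : X ⟶ Y) :
    mate X' Y' f = (ρ_ Y').inv ≫ Y' ◁ η_ X X' ≫ Y' ◁ f ▷ X' ≫ (α_ Y' Y X').inv ≫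
      ε_ Y Y' ▷ X' ≫ (λ_ X').hom := rfl

theorem mate_evaluation (f : X ⟶ Y) :
    mate X' Y' f ▷ X ≫ ε_ X X' = Y' ◁ f ≫ ε_ Y Y' :=
  letI : HasRightDual X := ⟨X'⟩
  letI : HasRightDual Y := ⟨Y'⟩
  rightAdjointMate_comp_evaluation f

/-- Evaluation is a nondegenerate pairing: a zigzag inserted after `g` turns it into a composite
that contains only `g ▷ X ≫ ε_ X X'`. All later formulas for mates are checked through this
characterisation. -/
theorem eq_mate {f : X ⟶ Y} {g : Y' ⟶ X'} (h : g ▷ X ≫ ε_ X X' = Y' ◁ f ≫ ε_ Y Y') :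
    g = mate X' Y' f := by
  calc
    g = g ≫ (ρ_ X').inv ≫ (X' ◁ η_ X X' ≫ (α_ _ _ _).inv ≫ ε_ X X' ▷ X') ≫ (λ_ X').hom := by simp
    _ = (ρ_ Y').inv ≫ (g ▷ 𝟙_ C ≫ X' ◁ η_ X X') ≫ (α_ _ _ _).inv ≫ ε_ X X' ▷ X' ≫ (λ_ X').hom := by
      simp
    _ = (ρ_ Y').inv ≫ Y' ◁ η_ X X' ≫ (α_ _ _ _).inv ≫ (g ▷ X ≫ ε_ X X') ▷ X' ≫ (λ_ X').hom := by
      rw [← whisker_exchange]; simp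
    _ = mate X' Y' f := by rw [h, mate_def]; simp

theorem mate_id : mate X' X' (𝟙 X) = 𝟙 X' := (eq_mate (by simp)).symm

theorem mate_comp (f : X ⟶ Y) (g : Y ⟶ Z) :
    mate X' Z' (f ≫ g) = mate Y' Z' g ≫ mate X' Y' f := by
  refine (eq_mate ?_).symm
  rw [comp_whiskerRight, Category.assoc, mate_evaluation, ← whisker_exchange_assoc,
    mate_evaluation, whiskerLeft_comp, Category.assoc]

theorem mate_whiskerLeft (W : C) {W' : C} [ExactPairing W W'] (f : X ⟶ Y) :
    mate (X' ⊗ W') (Y' ⊗ W') (W ◁ f) = mate X' Y' f ▷ W' := by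
  refine (eq_mate ?_).symm
  simp only [ExactPairing.tensor_evaluation]
  calc
    _ = 𝟙 _ ⊗≫ (mate X' Y' f ▷ ((W' ⊗ W) ⊗ X) ≫ X' ◁ (ε_ W W' ▷ X)) ⊗≫ ε_ X X' := by monoidal
    _ = 𝟙 _ ⊗≫ Y' ◁ (ε_ W W' ▷ X) ⊗≫ (mate X' Y' f ▷ X ≫ ε_ X X') := by
      rw [← whisker_exchange]; monoidal
    _ = 𝟙 _ ⊗≫ Y' ◁ (ε_ W W' ▷ X ≫ 𝟙_ C ◁ f) ⊗≫ ε_ Y Y' := by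
      rw [mate_evaluation]; monoidal
    _ = _ := by rw [← whisker_exchange]; monoidal

theorem mate_whiskerRight (W : C) {W' : C} [ExactPairing W W'] (f : X ⟶ Y) :
    mate (W' ⊗ X') (W' ⊗ Y') (f ▷ W) = W' ◁ mate X' Y' f := by
  refine (eq_mate ?_).symm
  simp only [ExactPairing.tensor_evaluation]
  calc
    _ = 𝟙 _ ⊗≫ W' ◁ ((mate X' Y' f ▷ X ≫ ε_ X X') ▷ W) ⊗≫ ε_ W W' := by monoidal
    _ = _ := by rw [mate_evaluation]; monoidal

theorem mate_associator :
    mate (Z' ⊗ (Y' ⊗ X')) ((Z' ⊗ Y') ⊗ X') (α_ X Y Z).hom = (α_ Z' Y' X').hom := by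
  refine (eq_mate ?_).symm
  simp only [ExactPairing.tensor_evaluation]
  monoidal

theorem mate_associator_inv :
    mate ((Z' ⊗ Y') ⊗ X') (Z' ⊗ (Y' ⊗ X')) (α_ X Y Z).inv = (α_ Z' Y' X').inv := by
  refine (eq_mate ?_).symm
  simp only [ExactPairing.tensor_evaluation]
  monoidal

theorem mate_rightUnitor_inv :
    mate X' (𝟙_ C ⊗ X') (ρ_ X).inv = (λ_ X').hom := by
  refine (eq_mate ?_).symm
  have : ε_ (𝟙_ C) (𝟙_ C) = (ρ_ (𝟙_ C)).hom := rfl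
  simp only [ExactPairing.tensor_evaluation, this]
  monoidal

theorem mate_rightUnitor :
    mate (𝟙_ C ⊗ X') X' (ρ_ X).hom = (λ_ X').inv := by
  refine (eq_mate ?_).symm
  have : ε_ (𝟙_ C) (𝟙_ C) = (ρ_ (𝟙_ C)).hom := rfl
  simp only [ExactPairing.tensor_evaluation, this]
  monoidal

/-- As `U` and `D` are dual to each other on both sides, `U ⊗ D` is its own dual, and a half turn of
the cup is the cap for the opposite pairing. The proof straightens one zigzag. -/
theorem mate_coevaluation (U D : C) [ExactPairing U D] [ExactPairing D U] :
    mate (X := 𝟙_ C) (𝟙_ C) (U ⊗ D) (η_ U D) = ε_ D U := by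
  refine (eq_mate ?_).symm
  have : ε_ (𝟙_ C) (𝟙_ C) = (ρ_ (𝟙_ C)).hom := rfl
  simp only [ExactPairing.tensor_evaluation, this]
  calc
    _ = (ρ_ (U ⊗ D)).hom ≫ ε_ D U := by monoidal
    _ = 𝟙 _ ⊗≫ U ◁ (D ◁ η_ U D ⊗≫ ε_ U D ▷ D) ⊗≫ ε_ D U := by
      rw [ExactPairing.coevaluation_evaluation'']; monoidal
    _ = _ := by monoidal

theorem mate_evaluation_swap (U D : C) [ExactPairing U D] [ExactPairing D U] :
    mate (X := U ⊗ D) (U ⊗ D) (𝟙_ C) (ε_ D U) = η_ U D := by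
  refine (eq_mate ?_).symm
  have : ε_ (𝟙_ C) (𝟙_ C) = (ρ_ (𝟙_ C)).hom := rfl
  simp only [ExactPairing.tensor_evaluation, this]
  calc
    _ = 𝟙 _ ⊗≫ (η_ U D ▷ (U ⊗ D) ≫ (U ⊗ D) ◁ 𝟙 (U ⊗ D)) ⊗≫ U ◁ (ε_ U D ▷ D) ⊗≫ ε_ D U := by
      monoidal
    _ = 𝟙 _ ⊗≫ (η_ U D ▷ U ⊗≫ U ◁ ε_ U D) ▷ D ⊗≫ ε_ D U := by monoidal
    _ = _ := by rw [ExactPairing.evaluation_coevaluation'']; monoidal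

section Linear

variable {R : Type*} [CommRing R] [Preadditive C] [Linear R C] [MonoidalPreadditive C]
  [MonoidalLinear R C]

theorem mate_add (f g : X ⟶ Y) : mate X' Y' (f + g) = mate X' Y' f + mate X' Y' g := by
  simp [mate_def]

variable (R) in
theorem mate_smul (r : R) (f : X ⟶ Y) : mate X' Y' (r • f) = r • mate X' Y' f := by
  simp [mate_def]

end Linear

end Mates

/-! ### Bridges -/

section Bridges

variable {C : Type u} [Category.{v} C] [MonoidalCategory C] (U D : C) [ExactPairing U D]
  [ExactPairing D U]

/-- A cup inserted between `X` and `Y`. -/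
def insertCup (X Y : C) : X ⊗ Y ⟶ (X ⊗ U) ⊗ (D ⊗ Y) :=
  𝟙 _ ⊗≫ X ◁ η_ U D ▷ Y ⊗≫ 𝟙 _

/-- A cap inserted between `X` and `Y`. -/
def insertCap (X Y : C) : (X ⊗ U) ⊗ (D ⊗ Y) ⟶ X ⊗ Y :=
  𝟙 _ ⊗≫ X ◁ ε_ D U ▷ Y ⊗≫ 𝟙 _

/-- The web obtained from `f` and `g` by joining their inner strands by a cup and a cap. -/
def bridge {X Y V W : C} (f : X ⊗ U ⟶ V ⊗ U) (g : D ⊗ Y ⟶ D ⊗ W) : X ⊗ Y ⟶ V ⊗ W :=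
  insertCup U D X Y ≫ (f ⊗ₘ g) ≫ insertCap U D V W

variable {U D}

theorem tensorHom_insertCup {X Y V W : C} (f : X ⟶ V) (g : Y ⟶ W) :
    (f ⊗ₘ g) ≫ insertCup U D V W = insertCup U D X Y ≫ (f ▷ U ⊗ₘ D ◁ g) := by
  simp only [insertCup, MonoidalCategory.tensorHom_def]
  calc
    _ = f ▷ Y ⊗≫ V ◁ (𝟙_ C ◁ g ≫ η_ U D ▷ W) ⊗≫ 𝟙 _ := by monoidal
    _ = 𝟙 _ ⊗≫ (f ▷ (𝟙_ C) ≫ V ◁ η_ U D) ▷ Y ⊗≫ ((V ⊗ U) ⊗ D) ◁ g ⊗≫ 𝟙 _ := by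
      rw [whisker_exchange]; monoidal
    _ = _ := by rw [← whisker_exchange]; monoidal

theorem insertCap_tensorHom {X Y V W : C} (f : X ⟶ V) (g : Y ⟶ W) :
    insertCap U D X Y ≫ (f ⊗ₘ g) = (f ▷ U ⊗ₘ D ◁ g) ≫ insertCap U D V W := by
  simp only [insertCap, MonoidalCategory.tensorHom_def]
  calc
    _ = 𝟙 _ ⊗≫ (X ◁ ε_ D U ≫ f ▷ (𝟙_ C)) ▷ Y ⊗≫ V ◁ g := by monoidal
    _ = 𝟙 _ ⊗≫ f ▷ ((U ⊗ D) ⊗ Y) ⊗≫ V ◁ (ε_ D U ▷ Y ≫ 𝟙_ C ◁ g) ⊗≫ 𝟙 _ := by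
      rw [whisker_exchange]; monoidal
    _ = _ := by rw [← whisker_exchange]; monoidal

/-- Morphisms on the outer strands slide past the inner cup and cap by the interchange law. -/
theorem bridge_comp {X Y V W X₁ Y₁ V₁ W₁ : C} (f : X₁ ⊗ U ⟶ V₁ ⊗ U) (g : D ⊗ Y₁ ⟶ D ⊗ W₁)
    (s : X ⟶ X₁) (t : Y ⟶ Y₁) (s' : V₁ ⟶ V) (t' : W₁ ⟶ W) :
    bridge U D (s ▷ U ≫ f ≫ s' ▷ U) (D ◁ t ≫ g ≫ D ◁ t') =
      (s ⊗ₘ t) ≫ bridge U D f g ≫ (s' ⊗ₘ t') := by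
  simp only [bridge, Category.assoc, insertCap_tensorHom]
  rw [← Category.assoc (s ⊗ₘ t), tensorHom_insertCup]
  simp only [Category.assoc, tensorHom_comp_tensorHom_assoc]

theorem bridge_whiskerLeft (J : C) {X Y V W : C} (f : X ⊗ U ⟶ V ⊗ U) (g : D ⊗ Y ⟶ D ⊗ W) :
    bridge U D ((α_ J X U).hom ≫ J ◁ f ≫ (α_ J V U).inv) g =
      (α_ J X Y).hom ≫ J ◁ bridge U D f g ≫ (α_ J V W).inv := by
  simp only [bridge, insertCup, insertCap, MonoidalCategory.tensorHom_def]
  monoidal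

theorem bridge_whiskerRight (J : C) {X Y V W : C} (f : X ⊗ U ⟶ V ⊗ U) (g : D ⊗ Y ⟶ D ⊗ W) :
    bridge U D f ((α_ D Y J).inv ≫ g ▷ J ≫ (α_ D W J).hom) =
      (α_ X Y J).inv ≫ bridge U D f g ▷ J ≫ (α_ V W J).hom := by
  simp only [bridge, insertCup, insertCap, MonoidalCategory.tensorHom_def']
  monoidal

/-- The partial closure on the right of an endomorphism of `U ⊗ U`. -/
def closeRight (d : U ⊗ U ⟶ U ⊗ U) : U ⟶ U :=
  (ρ_ U).inv ≫ U ◁ η_ U D ≫ (α_ _ _ _).inv ≫ d ▷ D ≫ (α_ _ _ _).hom ≫ U ◁ ε_ D U ≫ (ρ_ U).hom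

theorem bridge_id_right (Y : C) (d : U ⊗ U ⟶ U ⊗ U) :
    bridge U D d (𝟙 (D ⊗ Y)) = closeRight (D := D) d ▷ Y := by
  simp only [bridge, insertCup, insertCap, MonoidalCategory.tensorHom_def, closeRight]
  monoidal

/-- Mirror of `bridge_id_right`. The mate of a partial closure on the right is the partial closure
of the mate on the left, because mates exchange the cup `η_ U D` and the cap `ε_ D U`. -/
theorem bridge_id_left (X : C) (d : U ⊗ U ⟶ U ⊗ U) :
    bridge U D (𝟙 (X ⊗ U)) (mate (D ⊗ D) (D ⊗ D) d) = X ◁ mate D D (closeRight (D := D) d) := by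
  rw [closeRight]
  rw [mate_comp (Y' := 𝟙_ C ⊗ D), mate_comp (Y' := (U ⊗ D) ⊗ D), mate_comp (Y' := U ⊗ (D ⊗ D)),
    mate_comp (Y' := U ⊗ (D ⊗ D)), mate_comp (Y' := (U ⊗ D) ⊗ D), mate_comp (Y' := 𝟙_ C ⊗ D),
    mate_rightUnitor_inv, mate_rightUnitor, mate_whiskerLeft, mate_whiskerLeft, mate_coevaluation,
    mate_evaluation_swap, mate_associator, mate_associator_inv, mate_whiskerRight]
  simp only [bridge, insertCup, insertCap, MonoidalCategory.tensorHom_def]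
  monoidal

end Bridges

/-! ### Quarter turns, and the commutation of raising and lowering -/

section Rotation

variable {C : Type u} [Category.{v} C] [MonoidalCategory C] {U D : C} [ExactPairing U D]
  [ExactPairing D U]

/-- An endomorphism of `U ⊗ U` rotated by a quarter turn, to the right. -/
def turnRight (d : U ⊗ U ⟶ U ⊗ U) : U ⊗ D ⟶ D ⊗ U :=
  (λ_ (U ⊗ D)).inv ≫ η_ D U ▷ (U ⊗ D) ≫ (α_ _ _ _).hom ≫
    D ◁ ((α_ _ _ _).inv ≫ d ▷ D ≫ (α_ _ _ _).hom ≫ U ◁ ε_ D U ≫ (ρ_ U).hom)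

/-- An endomorphism of `U ⊗ U` rotated by a quarter turn, to the left. -/
def turnLeft (d : U ⊗ U ⟶ U ⊗ U) : D ⊗ U ⟶ U ⊗ D :=
  (ρ_ (D ⊗ U)).inv ≫ (D ⊗ U) ◁ η_ U D ≫ (α_ _ _ _).inv ≫
    ((α_ _ _ _).hom ≫ D ◁ d ≫ (α_ _ _ _).inv ≫ ε_ U D ▷ U ≫ (λ_ U).hom) ▷ D

theorem turnRight_cap (d : U ⊗ U ⟶ U ⊗ U) :
    U ◁ turnRight (D := D) d ⊗≫ ε_ D U ▷ U =
      𝟙 _ ⊗≫ d ▷ D ⊗≫ U ◁ ε_ D U ⊗≫ 𝟙 _ := by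
  rw [turnRight]
  calc
    _ = 𝟙 _ ⊗≫ U ◁ η_ D U ▷ (U ⊗ D) ⊗≫
        ((U ⊗ D) ◁ (𝟙 (U ⊗ (U ⊗ D)) ⊗≫ d ▷ D ⊗≫ U ◁ ε_ D U ⊗≫ 𝟙 U) ≫ ε_ D U ▷ U) := by monoidal
    _ = 𝟙 _ ⊗≫ (U ◁ η_ D U ⊗≫ ε_ D U ▷ U) ▷ (U ⊗ D) ⊗≫ d ▷ D ⊗≫ U ◁ ε_ D U ⊗≫ 𝟙 _ := by
      rw [whisker_exchange]; monoidal
    _ = _ := by rw [ExactPairing.coevaluation_evaluation'']; monoidal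

theorem cup_mate (d : U ⊗ U ⟶ U ⊗ U) :
    η_ U D ▷ D ⊗≫ U ◁ mate (D ⊗ D) (D ⊗ D) d =
      𝟙 _ ⊗≫ D ◁ η_ U D ⊗≫ turnLeft (D := D) d ▷ D ⊗≫ 𝟙 _ := by
  rw [turnLeft, mate_def, ExactPairing.tensor_coevaluation, ExactPairing.tensor_evaluation]
  calc
    _ = 𝟙 _ ⊗≫ (η_ U D ▷ D ≫ (U ⊗ D) ◁ (𝟙 D ⊗≫ D ◁ η_ U D ⊗≫ (D ⊗ U) ◁ η_ U D ▷ D ⊗≫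
        D ◁ d ▷ (D ⊗ D) ⊗≫ ε_ U D ▷ (U ⊗ (D ⊗ D)) ⊗≫ 𝟙 (U ⊗ (D ⊗ D)))) ⊗≫
        U ◁ ε_ U D ▷ (D ⊗ D) ⊗≫ 𝟙 _ := by monoidal
    _ = 𝟙 _ ⊗≫ D ◁ η_ U D ⊗≫ (D ⊗ U) ◁ η_ U D ▷ D ⊗≫
        D ◁ d ▷ (D ⊗ D) ⊗≫ ε_ U D ▷ (U ⊗ (D ⊗ D)) ⊗≫
        (η_ U D ▷ U ⊗≫ U ◁ ε_ U D) ▷ (D ⊗ D) ⊗≫ 𝟙 _ := by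
      rw [← whisker_exchange]; monoidal
    _ = _ := by rw [ExactPairing.evaluation_coevaluation'']; monoidal

/-- An endomorphism of `D ⊗ U` rotated by a quarter turn. -/
def quarterTurn (f : D ⊗ U ⟶ D ⊗ U) : U ⊗ D ⟶ U ⊗ D :=
  𝟙 _ ⊗≫ (U ⊗ D) ◁ η_ U D ⊗≫ U ◁ f ▷ D ⊗≫ ε_ D U ▷ (U ⊗ D) ⊗≫ 𝟙 _

theorem quarterTurn_id : quarterTurn (𝟙 (D ⊗ U)) = ε_ D U ≫ η_ U D := by
  rw [quarterTurn]
  calc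
    _ = 𝟙 _ ⊗≫ ((U ⊗ D) ◁ η_ U D ≫ ε_ D U ▷ (U ⊗ D)) ⊗≫ 𝟙 _ := by monoidal
    _ = _ := by rw [whisker_exchange]; monoidal

theorem quarterTurn_cap_cup : quarterTurn (ε_ U D ≫ η_ D U) = 𝟙 (U ⊗ D) := by
  rw [quarterTurn]
  calc
    _ = 𝟙 _ ⊗≫ U ◁ (D ◁ η_ U D ⊗≫ ε_ U D ▷ D) ⊗≫
        (U ◁ η_ D U ⊗≫ ε_ D U ▷ U) ▷ D ⊗≫ 𝟙 _ := by monoidal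
    _ = _ := by
      rw [ExactPairing.coevaluation_evaluation'', ExactPairing.coevaluation_evaluation'']
      monoidal

/-- A quarter turn of the mixed square straightens its bent strands: the right-turned factor becomes
`d` by `turnRight_cap`, the left-turned one becomes the mate of `d` by `cup_mate`. -/
theorem quarterTurn_turn (d : U ⊗ U ⟶ U ⊗ U) :
    quarterTurn (turnLeft (D := D) d ≫ turnRight d) =
      bridge U D d (mate (D ⊗ D) (D ⊗ D) d) := by
  rw [quarterTurn]
  calc
    _ = 𝟙 _ ⊗≫ U ◁ (𝟙 (𝟙_ C ⊗ D) ⊗≫ D ◁ η_ U D ⊗≫ turnLeft (D := D) d ▷ D ⊗≫ 𝟙 (U ⊗ (D ⊗ D))) ⊗≫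
        (U ◁ turnRight (D := D) d ⊗≫ ε_ D U ▷ U) ▷ D ⊗≫ 𝟙 _ := by monoidal
    _ = _ := by
      rw [turnRight_cap, ← cup_mate]
      simp only [bridge, insertCup, insertCap, MonoidalCategory.tensorHom_def']
      monoidal

variable {R : Type*} [CommRing R] [Preadditive C] [Linear R C] [MonoidalPreadditive C]
  [MonoidalLinear R C]

theorem quarterTurn_add_smul (f g : D ⊗ U ⟶ D ⊗ U) (r : R) :
    quarterTurn (f + r • g) = quarterTurn f + r • quarterTurn g := by
  simp [quarterTurn, monoidalComp]

/-- The quarter turn is linear and exchanges the identity with the cap-cup, so the mixed square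
relation keeps its shape with the two terms swapped. -/
theorem bridge_mate {d : U ⊗ U ⟶ U ⊗ U} {c : R}
    (h : turnLeft (D := D) d ≫ turnRight d = 𝟙 _ + c • (ε_ U D ≫ η_ D U)) :
    bridge U D d (mate (D ⊗ D) (D ⊗ D) d) = ε_ D U ≫ η_ U D + c • 𝟙 _ := by
  rw [← quarterTurn_turn, h, quarterTurn_add_smul, quarterTurn_id, quarterTurn_cap_cup]

theorem bridge_id_id {c : R} (h : η_ U D ≫ ε_ D U = c • 𝟙 (𝟙_ C)) (X Y : C) :
    bridge U D (𝟙 (X ⊗ U)) (𝟙 (D ⊗ Y)) = c • 𝟙 (X ⊗ Y) := by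
  calc
    _ = 𝟙 _ ⊗≫ X ◁ (η_ U D ≫ ε_ D U) ▷ Y ⊗≫ 𝟙 _ := by
      simp only [bridge, insertCup, insertCap, MonoidalCategory.tensorHom_def]
      monoidal
    _ = _ := by rw [h]; simp [monoidalComp]

variable {K J P K' J' P' : C} [ExactPairing K K'] [ExactPairing J J'] [ExactPairing P P']

theorem bridge_sub_sub (f : K ⊗ U ⟶ K ⊗ U) (g : D ⊗ K' ⟶ D ⊗ K') (r : R) :
    bridge U D (f - r • 𝟙 _) (g - r • 𝟙 _) =
      bridge U D f g - r • bridge U D f (𝟙 _) - r • bridge U D (𝟙 _) g +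
        (r * r) • bridge U D (𝟙 (K ⊗ U)) (𝟙 (D ⊗ K')) := by
  simp [bridge, MonoidalCategory.tensorHom_def, sub_eq_add_neg, ← neg_smul, mul_smul]
  module

variable (U D) in
/-- The cup between `X` and `Y` whose ends are merged with `X` and `Y`. -/
def raise {X Y V W : C} (f : X ⊗ U ⟶ V) (g : D ⊗ Y ⟶ W) : X ⊗ Y ⟶ V ⊗ W :=
  insertCup U D X Y ≫ (f ⊗ₘ g)

variable (U D) in
/-- The cap whose ends are split off from `V` and `W`. -/
def lower {X Y V W : C} (f : V ⟶ X ⊗ U) (g : W ⟶ D ⊗ Y) : V ⊗ W ⟶ X ⊗ Y :=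
  (f ⊗ₘ g) ≫ insertCap U D X Y

/-- Contravariance of mates joins the two downward vertices into the mate of `m ≫ s`. -/
theorem raise_lower (m : K ⊗ U ⟶ P) (s : P ⟶ K ⊗ U) :
    raise U D m (mate P' (D ⊗ K') s) ≫ lower U D s (mate (D ⊗ K') P' m) =
      bridge U D (m ≫ s) (mate (D ⊗ K') (D ⊗ K') (m ≫ s)) := by
  simp [raise, lower, bridge, mate_comp (Y' := P')]

/-- By the square switch, `m' ≫ s'` is a ladder `L` minus `n'` times the identity. Bilinearity of
`bridge` expands the left side into four bridges of `L`, its mate and identities. Those with an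
identity are scalars coming from circles and sideway digons; the bridge of `L` with its mate
contains the rotated mixed square, whose cap-cup term is `lower ≫ raise`. -/
theorem raise_lower_eq {d : U ⊗ U ⟶ U ⊗ U} {c₀ c₁ c₂ n n' : R}
    (h₂ : turnLeft (D := D) d ≫ turnRight d = 𝟙 _ + c₂ • (ε_ U D ≫ η_ D U))
    (h₁ : closeRight (D := D) d = c₁ • 𝟙 U) (h₀ : η_ U D ≫ ε_ D U = c₀ • 𝟙 (𝟙_ C))
    {s : K ⟶ J ⊗ U} {m : J ⊗ U ⟶ K} (hsm : s ≫ m = n • 𝟙 K)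
    {s' : P ⟶ K ⊗ U} {m' : K ⊗ U ⟶ P}
    (hms : s ▷ U ≫ (α_ J U U).hom ≫ J ◁ d ≫ (α_ J U U).inv ≫ m ▷ U = m' ≫ s' + n' • 𝟙 _) :
    raise U D m' (mate P' (D ⊗ K') s') ≫ lower U D s' (mate (D ⊗ K') P' m') =
      lower U D s (mate (D ⊗ J') K' m) ≫ raise U D m (mate K' (D ⊗ J') s) +
        (c₂ * n ^ 2 - 2 * n * n' * c₁ + n' ^ 2 * c₀) • 𝟙 (K ⊗ K') := by
  set L : K ⊗ U ⟶ K ⊗ U :=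
    s ▷ U ≫ ((α_ J U U).hom ≫ J ◁ d ≫ (α_ J U U).inv) ≫ m ▷ U with hL
  have hms' : m' ≫ s' = L - n' • 𝟙 _ := by
    rw [eq_sub_iff_add_eq, ← hms, hL]; simp
  have hL' : mate (D ⊗ K') (D ⊗ K') L = D ◁ mate (D ⊗ J') K' m ≫ ((α_ D D J').inv ≫
      mate (D ⊗ D) (D ⊗ D) d ▷ J' ≫ (α_ D D J').hom) ≫ D ◁ mate K' (D ⊗ J') s := by
    rw [hL, mate_comp (Y' := D ⊗ (D ⊗ J')), mate_comp (Y' := D ⊗ (D ⊗ J')),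
      mate_comp (Y' := (D ⊗ D) ⊗ J'), mate_comp (Y' := (D ⊗ D) ⊗ J'), mate_associator,
      mate_associator_inv, mate_whiskerLeft, mate_whiskerRight, mate_whiskerRight]
    simp
  have hsm' : mate (D ⊗ J') K' m ≫ mate K' (D ⊗ J') s = n • 𝟙 K' := by
    rw [← mate_comp, hsm, mate_smul R, mate_id]
  have e₀ : bridge U D (𝟙 (K ⊗ U)) (𝟙 (D ⊗ K')) = c₀ • 𝟙 (K ⊗ K') := bridge_id_id h₀ _ _
  -- Only `d` touches the inner loop: its partial closure contributes `c₁`, and what remains is the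
  -- digon `s ≫ m`.
  have e₁ : bridge U D L (𝟙 (D ⊗ K')) = (n * c₁) • 𝟙 (K ⊗ K') := by
    have := bridge_comp ((α_ J U U).hom ≫ J ◁ d ≫ (α_ J U U).inv) (𝟙 (D ⊗ K')) s (𝟙 _) m (𝟙 _)
    simp only [whiskerLeft_id, Category.comp_id] at this
    rw [hL, this, bridge_whiskerLeft, bridge_id_right, h₁]
    simp
    rw [← comp_whiskerRight, hsm]
    simp [smul_smul, mul_comm]
  have e₁' : bridge U D (𝟙 (K ⊗ U)) (mate (D ⊗ K') (D ⊗ K') L) = (n * c₁) • 𝟙 (K ⊗ K') := by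
    have := bridge_comp (𝟙 (K ⊗ U)) ((α_ D D J').inv ≫ mate (D ⊗ D) (D ⊗ D) d ▷ J' ≫
      (α_ D D J').hom) (𝟙 _) (mate (D ⊗ J') K' m) (𝟙 _) (mate K' (D ⊗ J') s)
    simp only [id_whiskerRight, Category.comp_id] at this
    rw [hL', this, bridge_whiskerRight, bridge_id_left, h₁, mate_smul R, mate_id]
    simp
    rw [← whiskerLeft_comp, hsm']
    simp [smul_smul, mul_comm]
  have e₂ : bridge U D L (mate (D ⊗ K') (D ⊗ K') L) =
      lower U D s (mate (D ⊗ J') K' m) ≫ raise U D m (mate K' (D ⊗ J') s) +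
        (c₂ * n ^ 2) • 𝟙 (K ⊗ K') := by
    rw [hL', hL, bridge_comp, bridge_whiskerLeft, bridge_whiskerRight, bridge_mate h₂]
    simp only [Preadditive.add_comp, Preadditive.comp_add, MonoidalPreadditive.add_whiskerRight,
      MonoidalPreadditive.whiskerLeft_add]
    congr 1
    -- The cap-cup term cuts the web into a lowering followed by a raising.
    · simp only [lower, raise, insertCup, insertCap, MonoidalCategory.tensorHom_def]
      monoidal
    -- The identity term leaves one digon on each side, hence the factor `n ^ 2`.
    · simp only [MonoidalLinear.whiskerLeft_smul, MonoidalLinear.smul_whiskerRight,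
        whiskerLeft_id, id_whiskerRight, Category.id_comp, Linear.smul_comp, Linear.comp_smul,
        Iso.hom_inv_id, Iso.inv_hom_id, tensorHom_comp_tensorHom, hsm, hsm']
      simp only [MonoidalCategory.tensorHom_def, MonoidalLinear.whiskerLeft_smul,
        MonoidalLinear.smul_whiskerRight, whiskerLeft_id, id_whiskerRight, Linear.comp_smul,
        Category.comp_id, smul_smul]
      ring_nf
  rw [raise_lower, hms', sub_eq_add_neg, ← neg_smul, mate_add, mate_smul R, mate_id, neg_smul,
    ← sub_eq_add_neg, neg_smul, ← sub_eq_add_neg, bridge_sub_sub, e₀, e₁, e₁', e₂]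
  module

end Rotation

/-! ### Quantum integers -/

section QuantumIntegers

theorem q_ne_zero : q ≠ 0 := RatFunc.X_ne_zero

theorem q_pow_ne_one {n : ℕ} (hn : n ≠ 0) : q ^ n ≠ 1 := by
  intro h
  have h' : algebraMap (Polynomial ℚ) (RatFunc ℚ) (Polynomial.X ^ n) =
      algebraMap (Polynomial ℚ) (RatFunc ℚ) 1 := by
    rw [map_pow, RatFunc.algebraMap_X, map_one]
    exact h
  have := congrArg Polynomial.natDegree (RatFunc.algebraMap_injective ℚ h')
  rw [Polynomial.natDegree_X_pow, Polynomial.natDegree_one] at this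
  exact hn this

theorem q_sq_sub_one_ne_zero : q ^ 2 - 1 ≠ 0 := sub_ne_zero.2 (q_pow_ne_one two_ne_zero)

theorem q_sub_inv_ne_zero : q - q⁻¹ ≠ 0 := by
  intro h
  apply q_sq_sub_one_ne_zero
  have h' : q * (q - q⁻¹) = q ^ 2 - 1 := by
    rw [mul_sub, mul_inv_cancel₀ q_ne_zero, sq]
  rw [← h', h, mul_zero]

theorem qInt_natCast (n : ℕ) : qInt q n = (q ^ (2 * n) - 1) / (q ^ 2 - 1) := by
  rw [qInt]
  norm_cast

theorem qInt_natCast_ne_zero {n : ℕ} (hn : n ≠ 0) : qInt q n ≠ 0 := by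
  rw [qInt_natCast]
  exact div_ne_zero (sub_ne_zero.2 (q_pow_ne_one (by omega))) q_sq_sub_one_ne_zero

/-- The numerator `{k+1}⋯{2}` and the denominator `{k}⋯{1}` cancel up to `{k+1}`, as `{1} = 1`. -/
theorem qBinom_succ_self (k : ℕ) : qBinom k ((k + 1 : ℕ) : ℤ) = qInt q ((k + 1 : ℕ) : ℤ) := by
  have h1 : qInt q 1 = 1 := by
    rw [qInt, mul_one, zpow_ofNat, div_self q_sq_sub_one_ne_zero]
  have h2 : ∏ i ∈ Finset.range k, qInt q (((k + 1 : ℕ) : ℤ) - i) =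
      ∏ i ∈ Finset.range k, qInt q ((i + 2 : ℕ) : ℤ) := by
    rw [← Finset.prod_range_reflect]
    refine Finset.prod_congr rfl fun i hi => ?_
    rw [Finset.mem_range] at hi
    congr 1
    omega
  have h3 : ∏ i ∈ Finset.range (k + 1), qInt q ((i + 1 : ℕ) : ℤ) =
      ∏ i ∈ Finset.range k, qInt q ((i + 2 : ℕ) : ℤ) := by
    rw [Finset.prod_range_succ']
    simp [h1, add_assoc]
  rw [qBinom, Finset.prod_div_distrib, h2, ← h3, Finset.prod_range_succ,
    div_eq_iff (Finset.prod_ne_zero_iff.2 fun i _ => by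
      exact_mod_cast qInt_natCast_ne_zero (Nat.succ_ne_zero i)), mul_comm]
  norm_cast

end QuantumIntegers

/-! ### Identities between quantum integers in a field -/

section FieldIdentities

variable {F : Type*} [Field F] {t : F}

/-- The left side is the square of `t⁻¹ [k+1] - [k] = t ^ (-(k+1))`, with symmetric quantum integers
`[n]`. -/
theorem field_identity_combination (ht : t ≠ 0) (h : t ^ 2 - 1 ≠ 0) (k : ℕ) :
    t⁻¹ ^ 2 * (t⁻¹ ^ (k * 1) * ((t ^ (2 * (k + 1)) - 1) / (t ^ 2 - 1))) ^ 2 -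
      2 * (t⁻¹ ^ (k * 1) * ((t ^ (2 * (k + 1)) - 1) / (t ^ 2 - 1))) *
        (t * (t ^ k)⁻¹ * ((t ^ (2 * k) - 1) / (t ^ 2 - 1))) * t⁻¹ ^ 1 +
      (t * (t ^ k)⁻¹ * ((t ^ (2 * k) - 1) / (t ^ 2 - 1))) ^ 2 * t⁻¹ ^ 0 = t⁻¹ ^ (2 * (k + 1)) := by
  have hk : t ^ k ≠ 0 := pow_ne_zero _ ht
  simp only [mul_one, mul_add, pow_add, pow_mul', inv_pow]
  generalize t ^ k = T at hk
  field_simp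
  ring

theorem field_identity_combination' (ht : t ≠ 0) (h : t ^ 2 - 1 ≠ 0) (k : ℕ) :
    t ^ 2 * (t⁻¹ ^ (k * 1) * ((t ^ (2 * (k + 1)) - 1) / (t ^ 2 - 1))) ^ 2 -
      2 * (t⁻¹ ^ (k * 1) * ((t ^ (2 * (k + 1)) - 1) / (t ^ 2 - 1))) *
        (t * (t ^ k)⁻¹ * ((t ^ (2 * k) - 1) / (t ^ 2 - 1))) * t ^ 1 +
      (t * (t ^ k)⁻¹ * ((t ^ (2 * k) - 1) / (t ^ 2 - 1))) ^ 2 * t ^ 0 = t ^ (2 * (k + 1)) := by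
  have hk : t ^ k ≠ 0 := pow_ne_zero _ ht
  simp only [mul_one, mul_add, pow_add, pow_mul', inv_pow]
  generalize t ^ k = T at hk
  field_simp
  ring

theorem field_identity_sum (ht : t ≠ 0) (h : t ^ 2 - 1 ≠ 0) (j m : ℕ) :
    t⁻¹ ^ m * ((t ^ (2 * (m + 1)) - 1) / (t ^ 2 - 1)) * t⁻¹ ^ (2 * j + m) +
        t⁻¹ ^ (2 * (j + (m + 1))) =
      t⁻¹ ^ (m + 1) * ((t ^ (2 * (m + 1 + 1)) - 1) / (t ^ 2 - 1)) * t⁻¹ ^ (2 * j + (m + 1)) := by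
  have hk : t ^ m ≠ 0 := pow_ne_zero _ ht
  have hj : t ^ j ≠ 0 := pow_ne_zero _ ht
  simp only [mul_add, pow_add, pow_mul', inv_pow]
  generalize t ^ m = T at hk
  generalize t ^ j = S at hj
  field_simp
  ring

theorem field_identity_sum' (ht : t ≠ 0) (h : t ^ 2 - 1 ≠ 0) (j m : ℕ) :
    t⁻¹ ^ m * ((t ^ (2 * (m + 1)) - 1) / (t ^ 2 - 1)) * t ^ (2 * j + m) +
        t ^ (2 * (j + (m + 1))) =
      t⁻¹ ^ (m + 1) * ((t ^ (2 * (m + 1 + 1)) - 1) / (t ^ 2 - 1)) * t ^ (2 * j + (m + 1)) := by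
  have hk : t ^ m ≠ 0 := pow_ne_zero _ ht
  have hj : t ^ j ≠ 0 := pow_ne_zero _ ht
  simp only [mul_add, pow_add, pow_mul', inv_pow]
  generalize t ^ m = T at hk
  generalize t ^ j = S at hj
  field_simp
  ring

end FieldIdentities

/-! ### Scalars in the commutation relation and their sums -/

section Coefficients

variable {R : Type u} [CommRing R] [Algebra (RatFunc ℚ) R] (a : Rˣ)

theorem circleVal_one : circleVal a 1 = aInt a 0 := by
  have h1 : qInt q 1 = 1 := by
    rw [qInt, mul_one, zpow_ofNat, div_self q_sq_sub_one_ne_zero]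
  simp [circleVal, h1]

/-- Evaluates the scalar of `raise_lower_eq` for `n = [k+1]` (digon) and `n' = [k]` (square switch).
Both sides are linear in `a` and `a⁻¹`; the two coefficients are compared by the field identities.
-/
theorem aInt_combination (k : ℕ) :
    aInt a 2 * algebraMap (RatFunc ℚ) R (q⁻¹ ^ (k * 1) * qBinom k ((k + 1 : ℕ) : ℤ)) ^ 2 -
      2 * algebraMap (RatFunc ℚ) R (q⁻¹ ^ (k * 1) * qBinom k ((k + 1 : ℕ) : ℤ)) *
        algebraMap (RatFunc ℚ) R (q ^ (1 - (k + 1 : ℕ) + (1 : ℕ) : ℤ) *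
          qInt q ((k + 1 : ℕ) - (1 : ℕ))) * aInt a 1 +
      algebraMap (RatFunc ℚ) R (q ^ (1 - (k + 1 : ℕ) + (1 : ℕ) : ℤ) *
          qInt q ((k + 1 : ℕ) - (1 : ℕ))) ^ 2 * circleVal a 1 = aInt a (2 * (k + 1)) := by
  have hk : ((k + 1 : ℕ) - (1 : ℕ) : ℤ) = (k : ℕ) := by push_cast; ring
  have he : (1 - (k + 1 : ℕ) + (1 : ℕ) : ℤ) = 1 - (k : ℤ) := by push_cast; ring
  rw [circleVal_one, qBinom_succ_self, hk, he, qInt_natCast, qInt_natCast]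
  simp only [aInt, Algebra.smul_def, ← map_pow]
  set A : R := (a : R)
  set B : R := ((a⁻¹ : Rˣ) : R)
  have hq := q_ne_zero
  have h2 := q_sq_sub_one_ne_zero
  have hz : q ^ (1 - (k : ℤ)) = q * (q ^ k)⁻¹ := by
    rw [zpow_sub₀ hq, zpow_one, zpow_natCast, div_eq_mul_inv]
  have key : ∀ x₀ x₁ x₂ n n' x : RatFunc ℚ, x₂ * n ^ 2 - 2 * n * n' * x₁ + n' ^ 2 * x₀ = x →
    algebraMap (RatFunc ℚ) R x₂ * algebraMap (RatFunc ℚ) R (n ^ 2) -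
      2 * algebraMap (RatFunc ℚ) R n * algebraMap (RatFunc ℚ) R n' * algebraMap (RatFunc ℚ) R x₁ +
      algebraMap (RatFunc ℚ) R (n' ^ 2) * algebraMap (RatFunc ℚ) R x₀ =
      algebraMap (RatFunc ℚ) R x := by
    rintro x₀ x₁ x₂ n n' x rfl
    simp only [map_add, map_sub, map_mul, map_pow, map_ofNat]
  set n := q⁻¹ ^ (k * 1) * ((q ^ (2 * (k + 1)) - 1) / (q ^ 2 - 1)) with hn
  set n' := q ^ (1 - (k : ℤ)) * ((q ^ (2 * k) - 1) / (q ^ 2 - 1)) with hn'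
  have e₁ := key (q⁻¹ ^ 0) (q⁻¹ ^ 1) (q⁻¹ ^ 2) n n' (q⁻¹ ^ (2 * (k + 1))) (by
    rw [hn, hn', hz]
    exact field_identity_combination hq h2 k)
  have e₂ := key (q ^ 0) (q ^ 1) (q ^ 2) n n' (q ^ (2 * (k + 1))) (by
    rw [hn, hn', hz]
    exact field_identity_combination' hq h2 k)
  rw [← e₁, ← e₂]
  ring

/-- The coefficients of `a` and `a⁻¹` are geometric sums. The closed form matters because it is a
product of factors that can each be inverted. -/
theorem sum_aInt (j m : ℕ) :
    ∑ i ∈ Finset.range (m + 1), aInt a (2 * (j + i)) =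
      algebraMap (RatFunc ℚ) R (q⁻¹ ^ m * qInt q ((m + 1 : ℕ) : ℤ)) * aInt a (2 * j + m) := by
  have hq := q_ne_zero
  have h2 := q_sq_sub_one_ne_zero
  simp only [qInt_natCast, aInt, Algebra.smul_def]
  induction m with
  | zero => simp [div_self h2]
  | succ m ih =>
    rw [Finset.sum_range_succ, ih]
    set A : R := (a : R)
    set B : R := ((a⁻¹ : Rˣ) : R)
    have key : ∀ x y n n' z : RatFunc ℚ, n * x + z = n' * y →
        algebraMap (RatFunc ℚ) R n * algebraMap (RatFunc ℚ) R x + algebraMap (RatFunc ℚ) R z =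
        algebraMap (RatFunc ℚ) R n' * algebraMap (RatFunc ℚ) R y := by
      intro x y n n' z h
      rw [← map_mul, ← map_mul, ← map_add, h]
    set n := q⁻¹ ^ m * ((q ^ (2 * (m + 1)) - 1) / (q ^ 2 - 1)) with hn
    set n' := q⁻¹ ^ (m + 1) * ((q ^ (2 * (m + 1 + 1)) - 1) / (q ^ 2 - 1)) with hn'
    have e₁ := key (q⁻¹ ^ (2 * j + m)) (q⁻¹ ^ (2 * j + (m + 1))) n n' (q⁻¹ ^ (2 * (j + (m + 1)))) (by
      rw [hn, hn']
      exact field_identity_sum hq h2 j m)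
    have e₂ := key (q ^ (2 * j + m)) (q ^ (2 * j + (m + 1))) n n' (q ^ (2 * (j + (m + 1)))) (by
      rw [hn, hn']
      exact field_identity_sum' hq h2 j m)
    linear_combination algebraMap (RatFunc ℚ) R (q - q⁻¹)⁻¹ * (A * e₁ - B * e₂)

end Coefficients

/-! ### Duality from zigzag relations -/

section Zigzag

variable {C : Type u} [Category.{v} C] [MonoidalCategory C]

/-- An exact pairing from zigzag relations that are closed up by unitors. -/
@[reducible]
def exactPairingOfZigzag {X Y : C} (η : 𝟙_ C ⟶ X ⊗ Y) (ε : Y ⊗ X ⟶ 𝟙_ C)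
    (h₁ : (ρ_ Y).inv ≫ Y ◁ η ≫ (α_ Y X Y).inv ≫ ε ▷ Y ≫ (λ_ Y).hom = 𝟙 Y)
    (h₂ : (λ_ X).inv ≫ η ▷ X ≫ (α_ X Y X).hom ≫ X ◁ ε ≫ (ρ_ X).hom = 𝟙 X) :
    ExactPairing X Y where
  coevaluation' := η
  evaluation' := ε
  coevaluation_evaluation' := by
    rw [Iso.inv_comp_eq, Category.comp_id] at h₁
    rw [Iso.eq_comp_inv, ← h₁]
    simp only [Category.assoc]
  evaluation_coevaluation' := by
    rw [Iso.inv_comp_eq, Category.comp_id] at h₂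
    rw [Iso.eq_comp_inv, ← h₂]
    simp only [Category.assoc]

end Zigzag

/-! ### Webs as a linear monoidal category with duals -/

section Category

variable {R : Type u} [CommRing R] [Algebra (RatFunc ℚ) R] (a : Rˣ)

open WebHom

instance : MonoidalPreadditive (InfWeb a) where
  whiskerLeft_zero {X Y Z} := by
    have h : ∀ f : Y ⟶ Z, X ◁ ((0 : R) • f) = (0 : R) • (X ◁ f) := fun f => by
      induction f using ind with | h f => exact sound (WebRel.tensor_smul _ _ _)
    simpa using h 0
  zero_whiskerRight {X Y Z} := by
    have h : ∀ f : Y ⟶ Z, ((0 : R) • f) ▷ X = (0 : R) • (f ▷ X) := fun f => by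
      induction f using ind with | h f => exact sound (WebRel.smul_tensor _ _ _)
    simpa using h 0
  whiskerLeft_add f g := by
    induction f using ind with | h f =>
    induction g using ind with | h g => exact sound (WebRel.tensor_add _ _ _)
  add_whiskerRight f g := by
    induction f using ind with | h f =>
    induction g using ind with | h g => exact sound (WebRel.add_tensor _ _ _)

instance : MonoidalLinear R (InfWeb a) where
  whiskerLeft_smul X _ _ r f := by
    induction f using ind with | h f => exact sound (WebRel.tensor_smul _ _ _)
  smul_whiskerRight r _ _ f X := by
    induction f using ind with | h f => exact sound (WebRel.smul_tensor _ _ _)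

/-- The upward strand labelled `k`, as an object of the web category. -/
def upObj (k : ℕ) : InfWeb a := ⟨up k⟩

/-- The downward strand labelled `k`, as an object of the web category. -/
def dnObj (k : ℕ) : InfWeb a := ⟨dn k⟩

/-- The merge vertex as a morphism. -/
def webMerge (k l m : ℕ) (h : k + l = m) : upObj a k ⊗ upObj a l ⟶ upObj a m :=
  mk a (WebTm.merge k l m h)

/-- The split vertex as a morphism. -/
def webSplit (k l m : ℕ) (h : k + l = m) : upObj a m ⟶ upObj a k ⊗ upObj a l :=
  mk a (WebTm.split k l m h)

instance exactPairingUp (k : ℕ) : ExactPairing (upObj a k) (dnObj a k) :=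
  exactPairingOfZigzag (mk a (WebTm.cupL k)) (mk a (WebTm.capL k))
    (sound (WebRel.zigzag_down_left k)) (sound (WebRel.zigzag_up_left k))

instance exactPairingDown (k : ℕ) : ExactPairing (dnObj a k) (upObj a k) :=
  exactPairingOfZigzag (mk a (WebTm.cupR k)) (mk a (WebTm.capR k))
    (sound (WebRel.zigzag_up_right k)) (sound (WebRel.zigzag_down_right k))

/-- The web `(k↑, k↓) → ((k+1)↑, (k+1)↓)` that creates an inner cup and merges it with the outer
strands. -/
def webRaise (k : ℕ) : upDown a k ⟶ upDown a (k + 1) :=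
  raise (upObj a 1) (dnObj a 1) (webMerge a k 1 (k + 1) rfl)
    (mate (dnObj a (k + 1)) (dnObj a 1 ⊗ dnObj a k) (webSplit a k 1 (k + 1) rfl))

/-- The web `((k+1)↑, (k+1)↓) → (k↑, k↓)` that splits off an inner cap. -/
def webLower (k : ℕ) : upDown a (k + 1) ⟶ upDown a k :=
  lower (upObj a 1) (dnObj a 1) (webSplit a k 1 (k + 1) rfl)
    (mate (dnObj a 1 ⊗ dnObj a k) (dnObj a (k + 1)) (webMerge a k 1 (k + 1) rfl))

theorem circle_one :
    η_ (upObj a 1) (dnObj a 1) ≫ ε_ (dnObj a 1) (upObj a 1) = circleVal a 1 • 𝟙 (𝟙_ (InfWeb a)) :=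
  sound (WebRel.circle_cw 1)

/-- Vertices with a `0`-labelled leg are unitors, so only a circle labelled `1` remains, of value
`c_0`. -/
theorem webRaise_webLower_zero : webRaise a 0 ≫ webLower a 0 = aInt a 0 • 𝟙 (upDown a 0) := by
  have h : webMerge a 0 1 1 rfl ≫ webSplit a 0 1 1 rfl = 𝟙 (upObj a 0 ⊗ upObj a 1) := by
    have h₁ : webMerge a 0 1 1 rfl = (λ_ (upObj a 1)).hom := sound (WebRel.merge_zero_left 1)
    have h₂ : webSplit a 0 1 1 rfl = (λ_ (upObj a 1)).inv := sound (WebRel.split_zero_left 1)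
    rw [h₁, h₂]
    exact (λ_ (upObj a 1)).hom_inv_id
  refine (raise_lower (U := upObj a 1) (D := dnObj a 1) (K := upObj a 0) (K' := dnObj a 0)
    (P := upObj a 1) (P' := dnObj a 1) (webMerge a 0 1 1 rfl) (webSplit a 0 1 1 rfl)).trans ?_
  rw [← circleVal_one, h, mate_id]
  exact bridge_id_id (circle_one a) _ _

theorem ladderLR_one (k : ℕ) :
    mk a (WebTm.ladderLR k 1) =
      webMerge a k 1 (k + 1) rfl ≫ webSplit a k 1 (k + 1) rfl := by
  have h₁ : webSplit a 1 0 1 rfl = (ρ_ (upObj a 1)).inv :=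
    sound (WebRel.split_zero_right 1)
  have h₂ : webMerge a 1 0 1 rfl = (ρ_ (upObj a 1)).hom :=
    sound (WebRel.merge_zero_right 1)
  refine Eq.trans (b := (upObj a k ◁ webSplit a 1 0 1 rfl ≫
      (α_ (upObj a k) (upObj a 1) (𝟙_ (InfWeb a))).inv ≫
      webMerge a k 1 (k + 1) rfl ▷ 𝟙_ (InfWeb a)) ≫
    (webSplit a k 1 (k + 1) rfl ▷ 𝟙_ (InfWeb a) ≫
      (α_ (upObj a k) (upObj a 1) (𝟙_ (InfWeb a))).hom ≫
      upObj a k ◁ webMerge a 1 0 1 rfl)) rfl ?_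
  rw [h₁, h₂]
  monoidal

/-- Two upward strands labelled `1` that merge and split again. -/
def webDumbbell : upObj a 1 ⊗ upObj a 1 ⟶ upObj a 1 ⊗ upObj a 1 :=
  webMerge a 1 1 2 rfl ≫ webSplit a 1 1 2 rfl

theorem turnLeft_turnRight_webDumbbell :
    turnLeft (D := dnObj a 1) (webDumbbell a) ≫ turnRight (webDumbbell a) =
      𝟙 _ + aInt a 2 • (ε_ (upObj a 1) (dnObj a 1) ≫ η_ (dnObj a 1) (upObj a 1)) := by
  have h₁ : turnLeft (D := dnObj a 1) (webDumbbell a) = mk a WebTm.sideL := rfl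
  have h₂ : turnRight (D := dnObj a 1) (webDumbbell a) = mk a WebTm.sideR := rfl
  rw [h₁, h₂]
  exact sound WebRel.square_mirror

theorem closeRight_webDumbbell :
    closeRight (D := dnObj a 1) (webDumbbell a) = aInt a 1 • 𝟙 (upObj a 1) :=
  sound WebRel.side_digon_right

theorem webRaise_webLower_succ (k : ℕ) :
    webRaise a (k + 1) ≫ webLower a (k + 1) =
      webLower a k ≫ webRaise a k + aInt a (2 * (k + 1)) • 𝟙 (upDown a (k + 1)) := by
  have hms := sound (WebRel.square_switch (a := a) (k + 1) 1)
  rw [mk_add, ladderLR_one] at hms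
  rw [← aInt_combination]
  refine raise_lower_eq (U := upObj a 1) (D := dnObj a 1) (J := upObj a k) (J' := dnObj a k)
    (K := upObj a (k + 1)) (K' := dnObj a (k + 1)) (P := upObj a (k + 2)) (P' := dnObj a (k + 2))
    (turnLeft_turnRight_webDumbbell a) (closeRight_webDumbbell a) (circle_one a)
    (sound (WebRel.digon k 1 (k + 1) rfl)) ?_
  refine Eq.trans ?_ hms
  -- The middle merge and split of the ladder `(k+1, 1) → (k, 2) → (k+1, 1)` compose to the
  -- dumbbell.
  refine Eq.trans (b := (webSplit a k 1 (k + 1) rfl ▷ upObj a 1 ≫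
      (α_ (upObj a k) (upObj a 1) (upObj a 1)).hom ≫ upObj a k ◁ webMerge a 1 1 2 rfl) ≫
    (upObj a k ◁ webSplit a 1 1 2 rfl ≫ (α_ (upObj a k) (upObj a 1) (upObj a 1)).inv ≫
      webMerge a k 1 (k + 1) rfl ▷ upObj a 1)) ?_ rfl
  simp [webDumbbell]

end Category

/-! ### Specialisation of `q`-rationals at `q = 1` -/

section Specialisation

/-- The rational function `f` is regular at `1`, with value `v`. -/
def HasValue (f : RatFunc ℚ) (v : ℚ) : Prop :=
  ∃ n d : Polynomial ℚ, d.eval 1 ≠ 0 ∧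
    f * algebraMap (Polynomial ℚ) (RatFunc ℚ) d = algebraMap (Polynomial ℚ) (RatFunc ℚ) n ∧
    n.eval 1 = v * d.eval 1

namespace HasValue

variable {f g : RatFunc ℚ} {v w : ℚ}

theorem unique (hf : HasValue f v) (hf' : HasValue f w) : v = w := by
  obtain ⟨n, d, hd, e, h⟩ := hf
  obtain ⟨n', d', hd', e', h'⟩ := hf'
  have key : n * d' = n' * d := by
    apply RatFunc.algebraMap_injective ℚ
    rw [map_mul, map_mul, ← e, ← e']
    ring
  have := congrArg (Polynomial.eval 1) key
  rw [Polynomial.eval_mul, Polynomial.eval_mul, h, h'] at this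
  apply mul_right_cancel₀ (mul_ne_zero hd hd')
  linear_combination this

theorem one : HasValue 1 1 := ⟨1, 1, by simp, by simp, by simp⟩

theorem add (hf : HasValue f v) (hg : HasValue g w) : HasValue (f + g) (v + w) := by
  obtain ⟨n, d, hd, e, h⟩ := hf
  obtain ⟨n', d', hd', e', h'⟩ := hg
  refine ⟨n * d' + n' * d, d * d', by simp [hd, hd'], ?_, ?_⟩
  · simp only [map_mul, map_add, ← e, ← e']
    ring
  · simp only [Polynomial.eval_mul, Polynomial.eval_add, h, h']
    ring

theorem neg (hf : HasValue f v) : HasValue (-f) (-v) := by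
  obtain ⟨n, d, hd, e, h⟩ := hf
  exact ⟨-n, d, hd, by rw [map_neg, ← e, neg_mul], by rw [Polynomial.eval_neg, h, neg_mul]⟩

theorem mul (hf : HasValue f v) (hg : HasValue g w) : HasValue (f * g) (v * w) := by
  obtain ⟨n, d, hd, e, h⟩ := hf
  obtain ⟨n', d', hd', e', h'⟩ := hg
  refine ⟨n * n', d * d', by simp [hd, hd'], ?_, ?_⟩
  · simp only [map_mul, ← e, ← e']
    ring
  · simp only [Polynomial.eval_mul, h, h']
    ring

theorem inv (hf : HasValue f v) (hv : v ≠ 0) : HasValue f⁻¹ v⁻¹ := by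
  obtain ⟨n, d, hd, e, h⟩ := hf
  have hn : n.eval 1 ≠ 0 := by rw [h]; exact mul_ne_zero hv hd
  have hn' : algebraMap (Polynomial ℚ) (RatFunc ℚ) n ≠ 0 := by
    rw [Ne, FaithfulSMul.algebraMap_eq_zero_iff]
    rintro rfl
    simp at hn
  have hf : f ≠ 0 := by
    rintro rfl
    rw [zero_mul] at e
    exact hn' e.symm
  refine ⟨d, n, hn, ?_, ?_⟩
  · rw [← e, inv_mul_cancel_left₀ hf]
  · rw [h, inv_mul_cancel_left₀ hv]

theorem div (hf : HasValue f v) (hg : HasValue g w) (hw : w ≠ 0) : HasValue (f / g) (v / w) := by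
  rw [div_eq_mul_inv, div_eq_mul_inv]
  exact hf.mul (hg.inv hw)

theorem zpow (hf : HasValue f 1) (hf' : f ≠ 0) (n : ℤ) : HasValue (f ^ n) 1 := by
  induction n with
  | zero => simpa using one
  | succ n ih => simpa [zpow_add_one₀ hf'] using ih.mul hf
  | pred n ih => simpa [zpow_sub_one₀ hf'] using ih.mul (hf.inv one_ne_zero)

end HasValue

theorem hasValue_q : HasValue q 1 :=
  ⟨Polynomial.X, 1, by simp, by simp [q], by simp⟩

theorem qInt_add_one {t : RatFunc ℚ} (ht : t ≠ 0) (ht' : t ^ 2 - 1 ≠ 0) (n : ℤ) :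
    qInt t (n + 1) = t ^ 2 * qInt t n + 1 := by
  have h : t ^ (2 * (n + 1)) = t ^ (2 * n) * t ^ 2 := by
    rw [mul_add, zpow_add₀ ht]
    norm_cast
  rw [qInt, qInt, h, div_eq_iff ht', add_mul, mul_assoc, div_mul_cancel₀ _ ht']
  ring

theorem HasValue.qInt {t : RatFunc ℚ} (h : HasValue t 1) (ht : t ≠ 0) (ht' : t ^ 2 - 1 ≠ 0)
    (n : ℤ) : HasValue (qInt t n) n := by
  have h2 : HasValue (t ^ 2) 1 := by simpa using h.zpow ht 2
  induction n with
  | zero =>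
    refine ⟨0, 1, by simp, by simp [QWeb.qInt], by simp⟩
  | succ n ih =>
    rw [qInt_add_one ht ht']
    simpa using (h2.mul ih).add HasValue.one
  | pred n ih =>
    have e := qInt_add_one ht ht' (-n - 1)
    rw [sub_add_cancel] at e
    have e' : QWeb.qInt t (-n - 1) = (t ^ 2)⁻¹ * (QWeb.qInt t (-n) + -1) := by
      rw [e, add_neg_cancel_right, inv_mul_cancel_left₀ (pow_ne_zero _ ht)]
    rw [e']
    simpa [sub_eq_add_neg] using (h2.inv one_ne_zero).mul (ih.add HasValue.one.neg)

theorem hasValue_qInt (n : ℤ) : HasValue (qInt q n) n :=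
  hasValue_q.qInt q_ne_zero q_sq_sub_one_ne_zero n

theorem hasValue_qInt_inv (n : ℤ) : HasValue (qInt q⁻¹ n) n := by
  refine HasValue.qInt (by simpa using hasValue_q.inv one_ne_zero) (inv_ne_zero q_ne_zero) ?_ n
  rw [inv_pow]
  intro h
  exact q_pow_ne_one two_ne_zero (inv_eq_one.1 (sub_eq_zero.1 h))

/-- An expansion `evenCF z` is never empty, so the recursive clause of `qCF` applies. -/
theorem qCF_evenCF_cons_cons (a b : ℤ) (z : ℚ) :
    qCF (a :: b :: evenCF z) =
      qInt q a + q ^ (2 * a) / (qInt q⁻¹ b + q ^ (-2 * b) / qCF (evenCF z)) := by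
  rw [evenCF]
  split_ifs
  · exact qCF.eq_4 _ _ _ _
  · exact qCF.eq_4 _ _ _ _

/-- At `q = 1` the deformed continued fraction becomes the ordinary one. No denominator vanishes
there, since the values at `q = 1` are the nonzero complete quotients. -/
theorem hasValue_qRat (x : ℚ) : HasValue (qRat x) x := by
  have hpos : ∀ x : ℚ, 0 < (x - (⌈x⌉ - 1 : ℤ))⁻¹ := fun x => by
    have := Int.ceil_lt_add_one x
    rw [inv_pos]
    push_cast
    linarith
  rw [qRat]
  induction x using evenCF.induct with
  | case1 x h =>
    rw [evenCF, if_pos h, qCF]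
    have hx := hpos x
    have := (hasValue_qInt (⌈x⌉ - 1)).add
      ((hasValue_q.zpow q_ne_zero (2 * (⌈x⌉ - 1))).div
        (hasValue_qInt_inv ⌊(x - (⌈x⌉ - 1 : ℤ))⁻¹⌋) (by rw [← h]; exact hx.ne'))
    rwa [← h, one_div, inv_inv, add_sub_cancel] at this
  | case2 x h ih =>
    rw [evenCF, if_neg h, qCF_evenCF_cons_cons]
    have hx := hpos x
    set y := (x - (⌈x⌉ - 1 : ℤ))⁻¹ with hy
    have hne : (y - ⌊y⌋)⁻¹ ≠ 0 := inv_ne_zero (sub_ne_zero.2 h)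
    have := (hasValue_qInt (⌈x⌉ - 1)).add
      ((hasValue_q.zpow q_ne_zero (2 * (⌈x⌉ - 1))).div
        ((hasValue_qInt_inv ⌊y⌋).add
          ((hasValue_q.zpow q_ne_zero (-2 * ⌊y⌋)).div ih hne)) (by
            rw [one_div, inv_inv, add_sub_cancel]; exact hx.ne'))
    rwa [one_div, one_div, inv_inv, add_sub_cancel, hy, inv_inv, add_sub_cancel] at this

/-- A shift of `x` by one changes only the first partial quotient, as `x - (⌈x⌉ - 1)` is invariant.
-/
theorem qRat_eq (x : ℚ) : qRat x = q ^ 2 * qRat (x - 1) + 1 := by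
  have hz : ∀ n : ℤ, q ^ (2 * n) = q ^ 2 * q ^ (2 * (n - 1)) := fun n => by
    rw [← zpow_natCast, ← zpow_add₀ q_ne_zero]
    congr 1
    push_cast
    ring
  have hi : ∀ n : ℤ, qInt q n = q ^ 2 * qInt q (n - 1) + 1 := fun n => by
    rw [← qInt_add_one q_ne_zero q_sq_sub_one_ne_zero, sub_add_cancel]
  have hx : x - 1 - (⌈x - 1⌉ - 1 : ℤ) = x - (⌈x⌉ - 1 : ℤ) := by
    rw [Int.ceil_sub_one]
    push_cast
    ring
  rw [qRat, qRat, evenCF.eq_def x, evenCF.eq_def (x - 1), hx, Int.ceil_sub_one]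
  split_ifs with h
  · rw [qCF, qCF, hi (⌈x⌉ - 1), hz (⌈x⌉ - 1)]
    ring
  · rw [qCF_evenCF_cons_cons, qCF_evenCF_cons_cons, hi (⌈x⌉ - 1), hz (⌈x⌉ - 1)]
    ring

theorem sq_mul_qDelta (x : ℚ) : q ^ 2 * qDelta x = (q ^ 2 - 1) * qRat x + 1 := by
  rw [qDelta]
  linear_combination qRat_eq x

theorem sq_mul_qDelta_ne (x : ℚ) {r : ℕ} (h : x ≠ r) : q ^ 2 * qDelta x ≠ q ^ (2 * r) := by
  intro e
  rw [sq_mul_qDelta] at e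
  have e' : qRat x = qInt q r := by
    rw [qInt_natCast, eq_div_iff q_sq_sub_one_ne_zero]
    linear_combination e
  have hr := hasValue_qInt r
  rw [← e'] at hr
  exact h ((hasValue_qRat x).unique (by exact_mod_cast hr))

theorem isUnit_aInt_xParam {R : Type u} [CommRing R] [Algebra (RatFunc ℚ) R] {x : ℚ}
    (hx : ∀ n : ℕ, x ≠ n) (ν : R) (hν : ν ^ 2 * algebraMap (RatFunc ℚ) R (qDelta x) = 1) (r : ℕ) :
    IsUnit (aInt (xParam x ν hν) r) := by
  have hν' : IsUnit ν :=
    IsUnit.of_mul_eq_one (ν * algebraMap (RatFunc ℚ) R (qDelta x)) (by rw [← hν]; ring)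
  -- Both `a` and `a⁻¹` are multiples of `ν` by scalars from `ℚ(q)`, so `c_r` is the unit `ν` times
  -- the image of an element of a field, which only has to be nonzero.
  have e : aInt (xParam x ν hν) r = ν * algebraMap (RatFunc ℚ) R
      ((q - q⁻¹)⁻¹ * (q⁻¹ ^ r * (q * qDelta x) - q ^ r * q⁻¹)) := by
    simp only [aInt, xParam, Units.inv_mk, Algebra.smul_def, map_mul, map_sub]
    ring
  rw [e]
  refine hν'.mul (IsUnit.map _ (IsUnit.mk0 _ (mul_ne_zero (inv_ne_zero q_sub_inv_ne_zero) ?_)))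
  intro h
  apply sq_mul_qDelta_ne x (hx r)
  have hq := q_ne_zero
  have h1 : q ^ r * q⁻¹ ^ r = 1 := by rw [← mul_pow, mul_inv_cancel₀ hq, one_pow]
  have h2 : q * q⁻¹ = 1 := mul_inv_cancel₀ hq
  linear_combination q ^ r * q * h - q ^ 2 * qDelta x * h1 + q ^ (2 * r) * h2

end Specialisation

/-! ### The doubled Schur algebra -/

section Category

variable {R : Type u} [CommRing R] [Algebra (RatFunc ℚ) R] (a : Rˣ)

open WebHom

theorem webCup_webCap (k : ℕ) :
    webCup a k ≫ webCap a k = circleVal a k • 𝟙 (𝟙_ (InfWeb a)) :=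
  sound (WebRel.circle_cw k)

variable {a} in
theorem isUnit_circleVal (h : ∀ r, IsUnit (aInt a r)) (k : ℕ) : IsUnit (circleVal a k) := by
  rw [circleVal, Algebra.smul_def]
  refine (IsUnit.map _ (IsUnit.mk0 _ (div_ne_zero (pow_ne_zero _ q_ne_zero) ?_))).mul ?_
  · exact Finset.prod_ne_zero_iff.2 fun i _ => by
      exact_mod_cast qInt_natCast_ne_zero (Nat.succ_ne_zero i)
  · exact (IsUnit.prod_iff).2 fun i _ => h i

namespace Schur

theorem capCup_mul_capCup (k l : ℕ) :
    capCup a k * capCup a l = if k = l then circleVal a k • capCup a k else 0 := by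
  split_ifs with h
  · subst h
    rw [capCup, entry_mul_entry_self, ← map_smul]
    congr 1
    rw [Category.assoc, ← Category.assoc (webCup a k), webCup_webCap]
    simp
  · exact entry_mul_entry_of_ne a _ _ _ _ (Ne.symm h) _ _

variable {a}

theorem idem_mul_idem (h : ∀ r, IsUnit (aInt a r)) (k l : ℕ) :
    idem a k * idem a l = if k = l then idem a k else 0 := by
  rw [idem, idem, smul_mul_smul_comm, capCup_mul_capCup]
  split_ifs with e
  · subst e
    rw [smul_smul, mul_assoc, Ring.inverse_mul_cancel _ (isUnit_circleVal h k), mul_one]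
  · rw [smul_zero]

/-- For `l = k` two circles arise, and one cancels against the normalisation of the idempotent. The
unitors are needed because `upDown a 0` is the tensor product of two units. -/
theorem cap_mul_idem_mul_cup (h : ∀ r, IsUnit (aInt a r)) (k l : ℕ) :
    entry a k 0 (webCap a k ≫ (λ_ (𝟙_ (InfWeb a))).inv) * idem a l *
        entry a 0 k ((λ_ (𝟙_ (InfWeb a))).hom ≫ webCup a k) =
      if l = k then circleVal a k • emptyWeb a else 0 := by
  rw [idem, mul_smul_comm, smul_mul_assoc, capCup]
  split_ifs with e
  · subst e
    rw [entry_mul_entry_self, entry_mul_entry_self, emptyWeb, ← map_smul, ← map_smul]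
    congr 1
    have e₁ : ((λ_ (𝟙_ (InfWeb a))).hom ≫ webCup a l) ≫ (webCap a l ≫ webCup a l) ≫ webCap a l ≫
        (λ_ (𝟙_ (InfWeb a))).inv = (λ_ (𝟙_ (InfWeb a))).hom ≫ (webCup a l ≫ webCap a l) ≫
        (webCup a l ≫ webCap a l) ≫ (λ_ (𝟙_ (InfWeb a))).inv := by
      simp only [Category.assoc]
    refine (congrArg _ e₁).trans ?_
    rw [webCup_webCap]
    simp only [Linear.smul_comp, Linear.comp_smul, Category.id_comp, Iso.hom_inv_id, smul_smul]
    refine (smul_smul _ _ (𝟙 (upDown a 0))).trans ?_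
    rw [← mul_assoc, Ring.inverse_mul_cancel _ (isUnit_circleVal h l), one_mul]
  · rw [entry_mul_entry_of_ne a _ _ _ _ e, zero_mul, smul_zero]

/-! ### Quotients of the doubled Schur algebra -/

section Quotient

variable {A : Type v} [NonUnitalRing A] [Module R A]

theorem linearIndependent_idem (h : ∀ r, IsUnit (aInt a r)) (π : Schur a →ₙₐ[R] A)
    [IsScalarTower R A A] [SMulCommClass R A A]
    (ht : ∀ r : R, r • π (emptyWeb a) = 0 → r = 0) :
    LinearIndependent R fun k : ℕ => π (idem a k) := by
  rw [linearIndependent_iff']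
  intro s g hg k hk
  -- Between the `k`-cap and the `k`-cup only the `k`-th term survives.
  have e := congrArg (fun y => π (entry a k 0 (webCap a k ≫ (λ_ (𝟙_ (InfWeb a))).inv)) * y *
    π (entry a 0 k ((λ_ (𝟙_ (InfWeb a))).hom ≫ webCup a k))) hg
  simp only [Finset.mul_sum, Finset.sum_mul, mul_zero, zero_mul, mul_smul_comm, smul_mul_assoc,
    ← map_mul, cap_mul_idem_mul_cup h] at e
  rw [Finset.sum_eq_single_of_mem k hk fun l _ hl => by rw [if_neg hl, map_zero, smul_zero],
    if_pos rfl, map_smul, smul_smul] at e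
  exact (isUnit_circleVal h k).mul_left_eq_zero.1 (ht _ e)

variable (a) in
/-- The iterated web `(j↑, j↓) → ((j+m)↑, (j+m)↓)`. -/
def iterRaise (j : ℕ) : (m : ℕ) → (upDown a j ⟶ upDown a (j + m))
  | 0 => 𝟙 (upDown a j)
  | m + 1 => iterRaise j m ≫ webRaise a (j + m)

variable (π : Schur a →ₙₐ[R] A)

theorem map_entry_comp {j k l : ℕ} (f : upDown a j ⟶ upDown a k) (g : upDown a k ⟶ upDown a l) :
    π (entry a j l (f ≫ g)) = π (entry a k l g) * π (entry a j k f) := by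
  rw [← map_mul, entry_mul_entry_self]

theorem map_entry_eq_zero_of_source {j k : ℕ} (h : π (entry a j j (𝟙 _)) = 0)
    (f : upDown a j ⟶ upDown a k) : π (entry a j k f) = 0 := by
  rw [← Category.id_comp f, map_entry_comp, h, mul_zero]

theorem map_entry_eq_zero_of_target {j k : ℕ} (h : π (entry a k k (𝟙 _)) = 0)
    (f : upDown a j ⟶ upDown a k) : π (entry a j k f) = 0 := by
  rw [← Category.comp_id f, map_entry_comp, h, zero_mul]

/-- The lowest weight computation: each commutation of the lowering past a raising adds one
`c_{2(j+i)}`, and the last remainder passes through an object below `j`, which `π` kills. -/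
theorem map_iterRaise_webLower [IsScalarTower R A A] [SMulCommClass R A A] {j : ℕ}
    (hj : ∀ i < j, π (entry a i i (𝟙 _)) = 0) (m : ℕ) :
    π (entry a j (j + m) (iterRaise a j (m + 1) ≫ webLower a (j + m))) =
      (∑ i ∈ Finset.range (m + 1), aInt a (2 * (j + i))) •
        π (entry a j (j + m) (iterRaise a j m)) := by
  induction m with
  | zero =>
    have e : iterRaise a j 1 ≫ webLower a j = webRaise a j ≫ webLower a j := by
      rw [iterRaise, iterRaise]
      exact congrArg (· ≫ webLower a j) (Category.id_comp (webRaise a j))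
    rw [Finset.sum_range_one]
    refine (congrArg (fun f => π (entry a j j f)) e).trans ?_
    rw [← map_smul, ← map_smul]
    cases j with
    | zero => rw [webRaise_webLower_zero]; rfl
    | succ j =>
      rw [webRaise_webLower_succ, map_add, map_add, map_entry_comp,
        map_entry_eq_zero_of_source π (hj j j.lt_succ_self), zero_mul, zero_add]
      rfl
  | succ m ih =>
    have e : iterRaise a j (m + 2) ≫ webLower a (j + (m + 1)) =
        (iterRaise a j (m + 1) ≫ webLower a (j + m)) ≫ webRaise a (j + m) +
          aInt a (2 * (j + (m + 1))) • iterRaise a j (m + 1) := by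
      rw [iterRaise, Category.assoc]
      refine (congrArg (iterRaise a j (m + 1) ≫ ·) (webRaise_webLower_succ a (j + m))).trans ?_
      rw [Preadditive.comp_add, Linear.comp_smul, Category.assoc]
      exact congrArg (_ + _ • ·) (Category.comp_id _)
    rw [e, map_add, map_add, map_smul, map_smul, Finset.sum_range_succ, add_smul]
    congr 1
    refine (map_entry_comp π _ (webRaise a (j + m))).trans ?_
    rw [ih, mul_smul_comm, ← map_entry_comp]
    rfl

theorem map_entry_id_eq_zero [IsScalarTower R A A] [SMulCommClass R A A]
    (h : ∀ r, IsUnit (aInt a r)) {N : ℕ} (hN : ∀ k, N ≤ k → π (entry a k k (𝟙 _)) = 0) (j : ℕ) :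
    π (entry a j j (𝟙 _)) = 0 := by
  induction j using Nat.strong_induction_on with
  | _ j hj =>
  -- Lowering recovers the `m`-fold raising from the `(m + 1)`-fold one up to an invertible scalar.
  have key : ∀ m, π (entry a j (j + (m + 1)) (iterRaise a j (m + 1))) = 0 →
      π (entry a j (j + m) (iterRaise a j m)) = 0 := by
    intro m hm
    have e := map_iterRaise_webLower π hj m
    have hu : IsUnit (∑ i ∈ Finset.range (m + 1), aInt a (2 * (j + i))) := by
      rw [sum_aInt]
      refine (IsUnit.map _ (IsUnit.mk0 _ (mul_ne_zero (pow_ne_zero _ (inv_ne_zero q_ne_zero))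
        (qInt_natCast_ne_zero m.succ_ne_zero)))).mul (h _)
    have e' : π (entry a j (j + m) (iterRaise a j (m + 1) ≫ webLower a (j + m))) = 0 := by
      refine (map_entry_comp π (iterRaise a j (m + 1)) (webLower a (j + m))).trans ?_
      rw [hm, mul_zero]
    rw [e'] at e
    exact hu.smul_eq_zero.1 e.symm
  have all : ∀ m, π (entry a j (j + m) (iterRaise a j m)) = 0 → π (entry a j j (𝟙 _)) = 0 := by
    intro m
    induction m with
    | zero => exact id
    | succ m ih => exact fun hm => ih (key m hm)
  -- The `N`-fold raising ends at `j + N ≥ N`, where the identity is already zero.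
  exact all N (map_entry_eq_zero_of_target π (hN _ (Nat.le_add_left N j)) _)

theorem exists_map_entry_id_mul_eq_zero (s : Schur a) :
    ∃ N, ∀ k, N ≤ k → π (entry a k k (𝟙 _)) * π s = 0 := by
  induction s using induct with
  | h0 => exact ⟨0, fun k _ => by rw [map_zero, mul_zero]⟩
  | h1 i l f =>
    refine ⟨l + 1, fun k hk => ?_⟩
    rw [← map_mul, entry_mul_entry_of_ne a _ _ _ _ (by omega), map_zero]
  | h2 f g hf hg =>
    obtain ⟨M, hM⟩ := hf
    obtain ⟨N, hN⟩ := hg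
    refine ⟨max M N, fun k hk => ?_⟩
    rw [map_add, mul_add, hM k (le_of_max_le_left hk), hN k (le_of_max_le_right hk), add_zero]

theorem not_finite_of_surjective [IsScalarTower R A A] [SMulCommClass R A A]
    (h : ∀ r, IsUnit (aInt a r)) (hπ : Function.Surjective π) [Nontrivial A] :
    ¬ Module.Finite R A := by
  intro hfin
  obtain ⟨S, hS⟩ := hfin.fg_top
  have hex : ∀ b : A, ∃ N, ∀ k, N ≤ k → π (entry a k k (𝟙 _)) * b = 0 := fun b => by
    obtain ⟨s, rfl⟩ := hπ b
    exact exists_map_entry_id_mul_eq_zero π s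
  choose N hN using hex
  -- Finite generation makes the bound uniform: the maximum over the generators serves for every
  -- element.
  have hann : ∀ k, S.sup N ≤ k → ∀ b : A, π (entry a k k (𝟙 _)) * b = 0 := by
    intro k hk b
    have hb : b ∈ Submodule.span R (S : Set A) := hS ▸ Submodule.mem_top
    induction hb using Submodule.span_induction with
    | mem b hb => exact hN b k ((Finset.le_sup hb).trans hk)
    | zero => rw [mul_zero]
    | add b c _ _ hb hc => rw [mul_add, hb, hc, add_zero]
    | smul r b _ hb => rw [mul_smul_comm, hb, smul_zero]
  -- An identity is idempotent, so it is among the elements that it annihilates.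
  have hid : ∀ k, S.sup N ≤ k → π (entry a k k (𝟙 _)) = 0 := fun k hk => by
    rw [← Category.comp_id (𝟙 (upDown a k)), map_entry_comp]
    exact hann k hk _
  have hzero : ∀ s : Schur a, π s = 0 := by
    intro s
    induction s using induct with
    | h0 => exact map_zero π
    | h1 k l f => exact map_entry_eq_zero_of_source π (map_entry_id_eq_zero π h hid k) f
    | h2 f g hf hg => rw [map_add, hf, hg, add_zero]
  obtain ⟨b, hb⟩ := exists_ne (0 : A)
  obtain ⟨s, rfl⟩ := hπ b
  exact hb (hzero s)

end Quotient

end Schur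

end Category

end QWeb

open QWeb in
theorem mainTheorem4 {R : Type u} [CommRing R] [Algebra (RatFunc ℚ) R]
    (x : ℚ) (hx : ∀ n : ℕ, x ≠ n)
    (ν : R) (hν : ν ^ 2 * algebraMap (RatFunc ℚ) R (qDelta x) = 1) :
    -- the value of the `k`-labelled circle is invertible
    (∀ k : ℕ, webCup (xParam x ν hν) k ≫ webCap (xParam x ν hν) k =
        circleVal (xParam x ν hν) k • 𝟙 (𝟙_ (XWeb x ν hν)) ∧
      IsUnit (circleVal (xParam x ν hν) k)) ∧
    -- the rescaled webs are orthogonal idempotents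
    (∀ k l : ℕ, Schur.capCup (xParam x ν hν) k * Schur.capCup (xParam x ν hν) l =
      if k = l then circleVal (xParam x ν hν) k • Schur.capCup (xParam x ν hν) k else 0) ∧
    (∀ k l : ℕ, Schur.idem (xParam x ν hν) k * Schur.idem (xParam x ν hν) l =
      if k = l then Schur.idem (xParam x ν hν) k else 0) ∧
    -- for every quotient algebra `A`
    (∀ (A : Type v) [NonUnitalRing A] [Module R A] [IsScalarTower R A A] [SMulCommClass R A A]
      (π : XSchur x ν hν →ₙₐ[R] A), Function.Surjective π →
      -- if the empty web is not torsion in `A`, the idempotents stay linearly independent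
      ((∀ r : R, r • π (Schur.emptyWeb (xParam x ν hν)) = 0 → r = 0) →
        LinearIndependent R fun k : ℕ => π (Schur.idem (xParam x ν hν) k)) ∧
      -- if `A` is not zero, it is not finite-dimensional
      (Nontrivial A → ¬ Module.Finite R A)) := by
  have h := isUnit_aInt_xParam hx ν hν
  exact ⟨fun k => ⟨webCup_webCap _ k, isUnit_circleVal h k⟩, Schur.capCup_mul_capCup _,
    Schur.idem_mul_idem h, fun A _ _ _ _ π hπ =>
      ⟨Schur.linearIndependent_idem h π, fun _ => Schur.not_finite_of_surjective π h hπ⟩⟩
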